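/- Let $n,m\ge 1$ and $s\ge 0$ be integers, let $\beta>1$, and let $x_0\in\mathbb R^n$ be an arbitrary $s$-sparse vector, i.e. a vector with at most $s$ nonzero coordinates. For an $m\times n$ real matrix $\Phi$, say that the recovery is exact if $x_0$ is the unique minimizer of $\|x\|_1=\sum_{i=1}^n|x_i|$ subject to $\Phi x=\Phi x_0$. (i) Suppose $s\ge 1$ and $\Phi$ is a Gaussian measurement map, i.e. its entries are i.i.d. Gaussian with mean $0$ and variance $1/m$. If $m\ge 2\beta s\log n+s$, then the recovery is exact with probability at least $1-2n^{-f(\beta,s)}$, where $$f(\beta,s)=\left[\sqrt{\frac{\beta}{2s}+\beta-1}-\sqrt{\frac{\beta}{2s}}\right]^2 .$$ (ii) There exist numerical constants $c_0,c_1>0$ (independent of $n,m,s,\beta,\varepsilon,x_0$) such that the following holds for every $\varepsilon\in(0,1)$. Suppose $\Phi$ is a binary measurement map, i.e. its entries are i.i.d. and take the values $\pm m^{-1/2}$ with equal probability. If $n\ge \exp(c_0/\varepsilon^2)$ and $m\ge 2\beta(1-\varepsilon)^{-2}s\log n+s$, then the recovery is exact with probability at least $1-n^{1-\beta}-n^{-c_1\beta\varepsilon^2}$.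 -/

import Mathlib

open MeasureTheory ProbabilityTheory
open scoped Matrix ENNReal NNReal

noncomputable section

/-- The `ℓ₁` norm on `ℝⁿ`. -/
def l1Norm {n : ℕ} (x : Fin n → ℝ) : ℝ := ∑ i, |x i|

/-- `x` is `s`-sparse: it has at most `s` nonzero coordinates. -/
def IsSparse {n : ℕ} (s : ℕ) (x : Fin n → ℝ) : Prop := hammingNorm x ≤ s

/-- Exact recovery of `x₀` from `Φ x₀`: the vector `x₀` is the unique minimizer of `‖x‖₁` subject
to `Φ x = Φ x₀`, that is, every other feasible point has strictly larger `ℓ₁` norm. -/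
def ExactRecovery {m n : ℕ} (Φ : Matrix (Fin m) (Fin n) ℝ) (x₀ : Fin n → ℝ) : Prop :=
  ∀ x : Fin n → ℝ, Φ *ᵥ x = Φ *ᵥ x₀ → x ≠ x₀ → l1Norm x₀ < l1Norm x

/-- The entries of the random matrix `Φ` are independent, each with law `ν`. -/
structure HasIIDEntries {Ω : Type*} [MeasurableSpace Ω] {m n : ℕ}
    (Φ : Ω → Matrix (Fin m) (Fin n) ℝ) (ν : Measure ℝ) (P : Measure Ω) : Prop where
  indep : iIndepFun (fun (p : Fin m × Fin n) ω => Φ ω p.1 p.2) P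
  law : ∀ i j, HasLaw (fun ω => Φ ω i j) ν P

/-- Gaussian measurement map: i.i.d. entries with mean `0` and variance `1 / m`. -/
def IsGaussianMap {Ω : Type*} [MeasurableSpace Ω] {m n : ℕ}
    (Φ : Ω → Matrix (Fin m) (Fin n) ℝ) (P : Measure Ω) : Prop :=
  HasIIDEntries Φ (gaussianReal 0 (1 / (m : ℝ≥0))) P

/-- The law of a random variable equal to `a` or `-a` with probability `1 / 2` each. -/
def symmetricSignLaw (a : ℝ) : Measure ℝ :=
  (2⁻¹ : ℝ≥0∞) • Measure.dirac a + (2⁻¹ : ℝ≥0∞) • Measure.dirac (-a)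

/-- Binary measurement map: i.i.d. entries equal to `± m ^ (-1/2)` with equal probability. -/
def IsBinaryMap {Ω : Type*} [MeasurableSpace Ω] {m n : ℕ}
    (Φ : Ω → Matrix (Fin m) (Fin n) ℝ) (P : Measure Ω) : Prop :=
  HasIIDEntries Φ (symmetricSignLaw (1 / Real.sqrt m)) P

/-- The exponent `f(β, s)` in the Gaussian case. -/
def recoveryExponent (β : ℝ) (s : ℕ) : ℝ :=
  (Real.sqrt (β / (2 * s) + β - 1) - Real.sqrt (β / (2 * s))) ^ 2

end

/-! Recovery follows from a dual certificate: a vector `q` whose products with the columns of `Φ`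
equal the signs of `x₀` on the support and are smaller than 1 in absolute value off it, the support
columns being independent. The candidate is the shortest `q` with the prescribed products on the
support. It depends on the support columns only, so once these are frozen the other columns are
still independent of it. With entries rescaled to unit variance, a subgaussian tail and a union
bound give conditional failure probability at most `min 1 (2n exp(-1/(2‖q‖²)))`
(`measure_not_exactRecovery_le`). Everything then rests on how small `‖q‖²` is; write `k ≤ s` for
the support size.

Gaussian case: rotating the support columns by an orthonormal basis containing `σ/√k` preserves
their law and bounds the squared distance from one Gaussian column to the span of the `k - 1` others
by `k/‖q‖²`. Since `min 1 (2z) ≤ 2 z^θ` for `θ ∈ [0,1]`, failure is bounded by a Laplace transform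
of chi-square type, `2 n^θ (1 + θ/k)^(-(m-k+1)/2)` (`lintegral_exp_neg_div_certVec_le`). A suitable
`θ` yields `f(β, s)`.

Binary case: a net argument with Bernstein-type concentration shows that the squared least singular
value of the support block is at least `m(1 - ε/2)` outside a rare event. There `‖q‖² ≤ k/(m(1 -
ε/2))`, and the tail bound gives `n^(1-β)`; the rare event costs the other term. -/

/-- Dual certificate criterion for exact recovery. -/
theorem exactRecovery_of_dualCertificate {m n : ℕ} {Φ : Matrix (Fin m) (Fin n) ℝ} {x₀ : Fin n → ℝ}
    (hinj : LinearIndependent ℝ (fun (j : {j // x₀ j ≠ 0}) i => Φ i j)) (q : Fin m → ℝ)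
    (hon : ∀ j, x₀ j ≠ 0 → q ⬝ᵥ (fun i => Φ i j) = SignType.sign (x₀ j))
    (hoff : ∀ j, x₀ j = 0 → |q ⬝ᵥ (fun i => Φ i j)| < 1) : ExactRecovery Φ x₀ := by
  intro x hx hne
  set h : Fin n → ℝ := x - x₀ with hh
  have hΦ : Φ *ᵥ h = 0 := by rw [hh, Matrix.mulVec_sub, hx, sub_self]
  have hz : ∑ j, (q ⬝ᵥ (fun i => Φ i j)) * h j = 0 := by
    have : (q ᵥ* Φ) ⬝ᵥ h = 0 := by rw [← Matrix.dotProduct_mulVec, hΦ, dotProduct_zero]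
    simpa [dotProduct, Matrix.vecMul] using this
  have hle : ∀ j, |x₀ j| + (q ⬝ᵥ (fun i => Φ i j)) * h j ≤ |x j| := by
    intro j
    by_cases hj : x₀ j = 0
    · have h1 : |x j| = |h j| := by simp [hh, hj]
      rw [h1, hj, abs_zero, zero_add]
      calc _ ≤ |(q ⬝ᵥ (fun i => Φ i j)) * h j| := le_abs_self _
        _ = |q ⬝ᵥ (fun i => Φ i j)| * |h j| := abs_mul _ _
        _ ≤ 1 * |h j| := by gcongr; exact (hoff j hj).le
        _ = |h j| := one_mul _
    · rw [hon j hj]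
      have : x j = x₀ j + h j := by simp [hh]
      rw [this]
      rcases lt_or_gt_of_ne hj with h0 | h0
      · simp only [sign_neg h0, abs_of_neg h0, SignType.coe_neg_one]
        linarith [neg_abs_le (x₀ j + h j)]
      · simp only [sign_pos h0, abs_of_pos h0, SignType.coe_one]
        linarith [le_abs_self (x₀ j + h j)]
  -- Equality in every coordinate would force `h` to vanish off the support, because there the
  -- certificate is strictly below 1. Then `Φ h = 0` is a relation among the independent support
  -- columns, so `h = 0`.
  have hstrict : ∃ j, |x₀ j| + (q ⬝ᵥ (fun i => Φ i j)) * h j < |x j| := by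
    by_contra hcon
    push Not at hcon
    have hoff0 : ∀ j, x₀ j = 0 → h j = 0 := by
      intro j hj
      by_contra hne0
      have h1 : |x j| = |h j| := by simp [hh, hj]
      have h2 := hcon j
      rw [h1, hj, abs_zero, zero_add] at h2
      have h3 : (q ⬝ᵥ (fun i => Φ i j)) * h j ≤ |q ⬝ᵥ (fun i => Φ i j)| * |h j| := by
        rw [← abs_mul]; exact le_abs_self _
      have h4 : |q ⬝ᵥ (fun i => Φ i j)| * |h j| < 1 * |h j| := by
        apply mul_lt_mul_of_pos_right (hoff j hj) (abs_pos.2 hne0)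
      linarith
    have hsum : ∑ j : {j // x₀ j ≠ 0}, h j • (fun i => Φ i j) = 0 := by
      have : ∑ j, h j • (fun i => Φ i j) = 0 := by
        rw [← hΦ]; ext i; simp [Matrix.mulVec, dotProduct, mul_comm]
      rw [← Fintype.sum_subtype_add_sum_subtype (fun j => x₀ j ≠ 0)] at this
      rwa [Finset.sum_eq_zero (s := (Finset.univ : Finset {j // ¬ x₀ j ≠ 0})), add_zero] at this
      rintro ⟨j, hj⟩ -
      rw [hoff0 j (not_not.1 hj), zero_smul]
    have hon0 := Fintype.linearIndependent_iff.1 hinj (fun j => h j) hsum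
    apply hne
    have : h = 0 := by
      ext j
      by_cases hj : x₀ j = 0
      · exact hoff0 j hj
      · exact hon0 ⟨j, hj⟩
    exact sub_eq_zero.1 this
  obtain ⟨j₀, hj₀⟩ := hstrict
  have := Finset.sum_lt_sum (fun j _ => hle j) ⟨j₀, Finset.mem_univ _, hj₀⟩
  rw [Finset.sum_add_distrib, hz, add_zero] at this
  exact this

/-! ### The least-squares certificate -/

section Certificate
variable {m : ℕ} {κ : Type*} [Fintype κ] [DecidableEq κ]

/-- The Gram matrix of the vectors `c j`. -/
noncomputable def colGram (c : κ → Fin m → ℝ) : Matrix κ κ ℝ := Matrix.of c * (Matrix.of c)ᵀ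

/-- The coefficients of the least-squares dual certificate. -/
noncomputable def certCoef (σ : κ → ℝ) (c : κ → Fin m → ℝ) : κ → ℝ := (colGram c)⁻¹ *ᵥ σ

/-- The least-squares dual certificate: the shortest vector `q` with `⟨q, c j⟩ = σ j`. -/
noncomputable def certVec (σ : κ → ℝ) (c : κ → Fin m → ℝ) : Fin m → ℝ :=
  certCoef σ c ᵥ* Matrix.of c

theorem isUnit_det_colGram {c : κ → Fin m → ℝ} (hc : LinearIndependent ℝ c) :
    IsUnit (colGram c).det := by
  have h : (colGram c).PosDef := by
    have := Matrix.PosDef.mul_conjTranspose_self (Matrix.of c) (R := ℝ)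
      (Matrix.vecMul_injective_iff.2 hc)
    rwa [Matrix.conjTranspose_eq_transpose_of_trivial] at this
  exact (Matrix.isUnit_iff_isUnit_det _).1 h.isUnit

theorem certVec_dotProduct_col {c : κ → Fin m → ℝ} (hc : LinearIndependent ℝ c) (σ : κ → ℝ)
    (j : κ) : certVec σ c ⬝ᵥ c j = σ j := by
  have h : Matrix.of c *ᵥ certVec σ c = σ := by
    rw [certVec, ← Matrix.mulVec_transpose, Matrix.mulVec_mulVec, certCoef]
    change colGram c *ᵥ _ = σ
    rw [Matrix.mulVec_mulVec, Matrix.mul_nonsing_inv _ (isUnit_det_colGram hc), Matrix.one_mulVec]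
  rw [dotProduct_comm]
  exact congrFun h j

theorem certVec_dotProduct_self {c : κ → Fin m → ℝ} (hc : LinearIndependent ℝ c) (σ : κ → ℝ) :
    certVec σ c ⬝ᵥ certVec σ c = certCoef σ c ⬝ᵥ σ := by
  conv_lhs => rw [certVec]
  rw [← Matrix.dotProduct_mulVec]
  congr 1
  ext j
  rw [← certVec_dotProduct_col hc σ j, dotProduct_comm]; rfl

theorem certVec_dotProduct_self_pos [Nonempty κ] {c : κ → Fin m → ℝ} (hc : LinearIndependent ℝ c)
    {σ : κ → ℝ} (hσ : ∀ j, σ j ≠ 0) : 0 < certVec σ c ⬝ᵥ certVec σ c := by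
  obtain ⟨j⟩ := ‹Nonempty κ›
  have h0 : 0 ≤ certVec σ c ⬝ᵥ certVec σ c :=
    Finset.sum_nonneg fun i _ => mul_self_nonneg _
  refine lt_of_le_of_ne h0 fun h => hσ j ?_
  rw [← certVec_dotProduct_col hc σ j, dotProduct_self_eq_zero.1 h.symm, zero_dotProduct]

theorem measurable_certCoef (σ : κ → ℝ) :
    Measurable (certCoef σ : (κ → Fin m → ℝ) → κ → ℝ) := by
  have hG : Continuous (colGram : (κ → Fin m → ℝ) → Matrix κ κ ℝ) := by
    unfold colGram
    apply Continuous.matrix_mul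
    · exact continuous_id
    · exact Continuous.matrix_transpose continuous_id
  refine measurable_pi_lambda _ fun j => ?_
  -- The adjugate formula reduces measurability to continuous functions and one scalar inverse; at
  -- singular Gram matrices both sides take the default value 0.
  have : (fun c : κ → Fin m → ℝ => certCoef σ c j) =
      fun c => ((colGram c).det)⁻¹ * ((colGram c).adjugate *ᵥ σ) j := by
    ext c
    simp [certCoef, Matrix.inv_def, Matrix.smul_mulVec]
  rw [this]
  refine (hG.matrix_det.measurable.inv).mul (Continuous.measurable ?_)
  exact (continuous_apply j).comp (hG.matrix_adjugate.matrix_mulVec continuous_const)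

theorem measurable_certVec (σ : κ → ℝ) :
    Measurable (certVec σ : (κ → Fin m → ℝ) → Fin m → ℝ) := by
  have := measurable_certCoef (m := m) σ
  refine measurable_pi_lambda _ fun i => ?_
  unfold certVec
  simp only [Matrix.vecMul, dotProduct, Matrix.of_apply]
  fun_prop

end Certificate

/-! ### Joint law of the columns -/

theorem measurableSet_linearIndependent {m : ℕ} {κ : Type*} [Fintype κ] :
    MeasurableSet {c : κ → Fin m → ℝ | LinearIndependent ℝ c} :=
  isOpen_setOfPred_linearIndependent.measurableSet

/-- The law of a family of vectors in `ℝᵐ` whose coordinates are i.i.d. with law `ν`. -/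
noncomputable def iidCols (κ : Type*) [Fintype κ] (m : ℕ) (ν : Measure ℝ) :
    Measure (κ → Fin m → ℝ) :=
  Measure.pi fun _ => Measure.pi fun _ => ν

instance (κ : Type*) [Fintype κ] (m : ℕ) (ν : Measure ℝ) [IsProbabilityMeasure ν] :
    IsProbabilityMeasure (iidCols κ m ν) := by unfold iidCols; infer_instance

section Curry
variable {ι κ : Type*} [Fintype ι] [Fintype κ] (ν : Measure ℝ) [IsProbabilityMeasure ν]

theorem map_uncurry_pi_pi :
    (Measure.pi fun _ : ι => Measure.pi fun _ : κ => ν).map (fun c (p : ι × κ) => c p.1 p.2) =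
      Measure.pi fun _ => ν := by
  refine (Measure.pi_eq fun s hs => ?_).symm
  rw [Measure.map_apply (by fun_prop) (MeasurableSet.univ_pi hs)]
  have : (fun (c : ι → κ → ℝ) (p : ι × κ) => c p.1 p.2) ⁻¹' Set.univ.pi s =
      Set.univ.pi fun i => Set.univ.pi fun j => s (i, j) := by
    ext c; simp [Set.mem_pi]
  rw [this, Measure.pi_pi, Fintype.prod_prod_type]
  simp_rw [Measure.pi_pi]

theorem map_uncurry_swap_pi_pi :
    (Measure.pi fun _ : κ => Measure.pi fun _ : ι => ν).map (fun c (p : ι × κ) => c p.2 p.1) =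
      Measure.pi fun _ => ν := by
  refine (Measure.pi_eq fun s hs => ?_).symm
  rw [Measure.map_apply (by fun_prop) (MeasurableSet.univ_pi hs)]
  have : (fun (c : κ → ι → ℝ) (p : ι × κ) => c p.2 p.1) ⁻¹' Set.univ.pi s =
      Set.univ.pi fun j => Set.univ.pi fun i => s (i, j) := by
    ext c; simp only [Set.mem_preimage, Set.mem_pi, Set.mem_univ, true_imp_iff, Prod.forall]
    exact forall_comm
  rw [this, Measure.pi_pi, Fintype.prod_prod_type_right]
  simp_rw [Measure.pi_pi]

theorem map_curry_swap_pi :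
    (Measure.pi fun _ : ι × κ => ν).map (fun f j i => f (i, j)) =
      Measure.pi fun _ : κ => Measure.pi fun _ : ι => ν := by
  rw [← map_uncurry_swap_pi_pi, Measure.map_map (by fun_prop) (by fun_prop)]
  exact Measure.map_id

theorem measurePreserving_transpose :
    MeasurePreserving (fun (c : κ → ι → ℝ) i j => c j i)
      (Measure.pi fun _ : κ => Measure.pi fun _ : ι => ν)
      (Measure.pi fun _ : ι => Measure.pi fun _ : κ => ν) := by
  refine ⟨by fun_prop, ?_⟩
  rw [← map_curry_swap_pi, ← map_uncurry_pi_pi, Measure.map_map (by fun_prop) (by fun_prop),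
    Measure.map_map (by fun_prop) (by fun_prop)]
  exact Measure.map_id

end Curry

theorem aemeasurable_columns {Ω : Type*} [MeasurableSpace Ω] {P : Measure Ω} {m n : ℕ}
    {Φ : Ω → Matrix (Fin m) (Fin n) ℝ} {ν : Measure ℝ} (h : HasIIDEntries Φ ν P) :
    AEMeasurable (fun ω (j : Fin n) i => Φ ω i j) P :=
  aemeasurable_pi_lambda _ fun j => aemeasurable_pi_lambda _ fun i => (h.law i j).aemeasurable

theorem map_columns {Ω : Type*} [MeasurableSpace Ω] {P : Measure Ω} [IsProbabilityMeasure P]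
    {m n : ℕ} {Φ : Ω → Matrix (Fin m) (Fin n) ℝ} {ν : Measure ℝ} [IsProbabilityMeasure ν]
    (h : HasIIDEntries Φ ν P) : P.map (fun ω j i => Φ ω i j) = iidCols (Fin n) m ν := by
  have h1 := (iIndepFun_iff_map_fun_eq_pi_map
    (f := fun (p : Fin m × Fin n) ω => Φ ω p.1 p.2)
    fun p => (h.law p.1 p.2).aemeasurable).1 h.indep
  simp_rw [fun p : Fin m × Fin n => (h.law p.1 p.2).map_eq] at h1
  rw [iidCols, ← map_curry_swap_pi, ← h1, AEMeasurable.map_map_of_aemeasurable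
    (Measurable.aemeasurable (by fun_prop))]
  · rfl
  · exact aemeasurable_pi_lambda _ fun p => (h.law p.1 p.2).aemeasurable

/-! ### Subgaussian tails and the conditional failure bound -/

theorem hasSubgaussianMGF_dotProduct {ι : Type*} [Fintype ι] {ν : Measure ℝ} [IsProbabilityMeasure ν]
    (hν : HasSubgaussianMGF id 1 ν) (q : ι → ℝ) :
    HasSubgaussianMGF (fun y => q ⬝ᵥ y) (q ⬝ᵥ q).toNNReal (Measure.pi fun _ : ι => ν) := by
  have hcoord : ∀ i, HasSubgaussianMGF (fun y : ι → ℝ => q i * y i)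
      (NNReal.mk (q i ^ 2) (sq_nonneg _) * 1) (Measure.pi fun _ : ι => ν) := fun i => by
    have : HasSubgaussianMGF (fun y : ι → ℝ => y i) 1 (Measure.pi fun _ : ι => ν) :=
      HasSubgaussianMGF.of_map (Y := fun y : ι → ℝ => y i) (X := id)
        (measurable_pi_apply i).aemeasurable
        (by rwa [(measurePreserving_eval (fun _ : ι => ν) i).map_eq])
    exact this.const_mul (q i)
  have hind : iIndepFun (fun i (y : ι → ℝ) => q i * y i) (Measure.pi fun _ : ι => ν) :=
    iIndepFun_pi (X := fun i x => q i * x) fun i => by fun_prop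
  have := HasSubgaussianMGF.sum_of_iIndepFun hind (s := Finset.univ) fun i _ => hcoord i
  have hc : (q ⬝ᵥ q).toNNReal = ∑ i, NNReal.mk (q i ^ 2) (sq_nonneg _) * 1 := by
    have h0 : 0 ≤ q ⬝ᵥ q := Finset.sum_nonneg fun i _ => mul_self_nonneg _
    apply NNReal.eq
    rw [Real.coe_toNNReal _ h0, NNReal.coe_sum]
    refine Finset.sum_congr rfl fun i _ => ?_
    rw [NNReal.coe_mul, NNReal.coe_one, mul_one, NNReal.coe_mk, sq]
  rw [hc]
  exact this

theorem measure_one_le_abs_dotProduct_le {ι : Type*} [Fintype ι] {ν : Measure ℝ}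
    [IsProbabilityMeasure ν] (hν : HasSubgaussianMGF id 1 ν) (q : ι → ℝ) :
    (Measure.pi fun _ : ι => ν) {y | 1 ≤ |q ⬝ᵥ y|} ≤
      ENNReal.ofReal (2 * Real.exp (-1 / (2 * (q ⬝ᵥ q)))) := by
  set μ := Measure.pi fun _ : ι => ν
  have h := hasSubgaussianMGF_dotProduct hν q
  have hq : ((q ⬝ᵥ q).toNNReal : ℝ) = q ⬝ᵥ q :=
    Real.coe_toNNReal _ (Finset.sum_nonneg fun i _ => mul_self_nonneg _)
  have h1 := h.measure_ge_le zero_le_one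
  have h2 := h.neg.measure_ge_le zero_le_one
  rw [hq, one_pow] at h1 h2
  rw [← ofReal_measureReal]
  apply ENNReal.ofReal_le_ofReal
  calc μ.real {y | 1 ≤ |q ⬝ᵥ y|}
      ≤ μ.real ({y | 1 ≤ q ⬝ᵥ y} ∪ {y | 1 ≤ (-fun y => q ⬝ᵥ y) y}) :=
        measureReal_mono fun y hy => by simpa [le_abs] using hy
    _ ≤ _ := measureReal_union_le _ _
    _ ≤ _ := by linarith

theorem measure_exists_one_le_abs_dotProduct_le {κ : Type*} [Fintype κ] {m : ℕ} {ν : Measure ℝ}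
    [IsProbabilityMeasure ν] (hν : HasSubgaussianMGF id 1 ν) (q : Fin m → ℝ) :
    iidCols κ m ν {y | ∃ j, 1 ≤ |q ⬝ᵥ y j|} ≤
      ENNReal.ofReal (2 * Fintype.card κ * Real.exp (-1 / (2 * (q ⬝ᵥ q)))) := by
  have hE : {y : κ → Fin m → ℝ | ∃ j, 1 ≤ |q ⬝ᵥ y j|} = ⋃ j, {y | 1 ≤ |q ⬝ᵥ y j|} := by
    ext; simp
  have hm : MeasurableSet {y : Fin m → ℝ | 1 ≤ |q ⬝ᵥ y|} := by
    apply measurableSet_le measurable_const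
    simp only [dotProduct]
    fun_prop
  have hj : ∀ j, iidCols κ m ν {y | 1 ≤ |q ⬝ᵥ y j|} ≤
      ENNReal.ofReal (2 * Real.exp (-1 / (2 * (q ⬝ᵥ q)))) := fun j => by
    refine le_trans (le_of_eq ?_) (measure_one_le_abs_dotProduct_le hν q)
    exact (measurePreserving_eval (fun _ : κ => Measure.pi fun _ : Fin m => ν) j).measure_preimage
      hm.nullMeasurableSet
  rw [hE]
  refine (measure_iUnion_fintype_le _ _).trans ((Finset.sum_le_sum fun j _ => hj j).trans ?_)
  rw [Finset.sum_const, nsmul_eq_mul, Finset.card_univ, ← ENNReal.ofReal_natCast,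
    ← ENNReal.ofReal_mul (by positivity)]
  apply ENNReal.ofReal_le_ofReal
  apply le_of_eq
  ring

/-- The sign pattern of `x₀` on its support. -/
noncomputable def supportSign {n : ℕ} (x₀ : Fin n → ℝ) (j : {j // x₀ j ≠ 0}) : ℝ :=
  (SignType.sign (x₀ j) : ℝ)

theorem abs_supportSign {n : ℕ} (x₀ : Fin n → ℝ) (j) : |supportSign x₀ j| = 1 := by
  rcases lt_or_gt_of_ne j.2 with h | h
  · simp [supportSign, sign_neg h]
  · simp [supportSign, sign_pos h]

/-- By Fubini: the columns split into two independent blocks, on and off the support. With the first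
block fixed, the certificate is a constant vector to which the union bound applies. The cap at 1 is
what later allows the bound to be raised to a power `θ ≤ 1`. -/
theorem measure_not_exactRecovery_le {Ω : Type*} [MeasurableSpace Ω] {P : Measure Ω}
    [IsProbabilityMeasure P] {m n : ℕ} {Φ : Ω → Matrix (Fin m) (Fin n) ℝ} {ν : Measure ℝ}
    [IsProbabilityMeasure ν] (hν : HasSubgaussianMGF id 1 ν) (hΦ : HasIIDEntries Φ ν P)
    (x₀ : Fin n → ℝ) :
    P {ω | ¬ ExactRecovery (Φ ω) x₀} ≤
      iidCols {j // x₀ j ≠ 0} m ν {c | ¬ LinearIndependent ℝ c} +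
      ∫⁻ c in {c | LinearIndependent ℝ c}, min 1 (ENNReal.ofReal (2 * n * Real.exp
        (-1 / (2 * (certVec (supportSign x₀) c ⬝ᵥ certVec (supportSign x₀) c)))))
        ∂(iidCols {j // x₀ j ≠ 0} m ν) := by
  classical
  set κ := {j // x₀ j ≠ 0}
  set σ := supportSign x₀
  let B : Set ((κ → Fin m → ℝ) × ({j // ¬ x₀ j ≠ 0} → Fin m → ℝ)) :=
    {p | LinearIndependent ℝ p.1 ∧ ∃ j, 1 ≤ |certVec σ p.1 ⬝ᵥ p.2 j|}
  have hB : MeasurableSet B := by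
    refine MeasurableSet.inter (measurable_fst measurableSet_linearIndependent) ?_
    have : {p : (κ → Fin m → ℝ) × ({j // ¬ x₀ j ≠ 0} → Fin m → ℝ) |
        ∃ j, 1 ≤ |certVec σ p.1 ⬝ᵥ p.2 j|} = ⋃ j, {p | 1 ≤ |certVec σ p.1 ⬝ᵥ p.2 j|} := by
      ext; simp
    change MeasurableSet {p : (κ → Fin m → ℝ) × ({j // ¬ x₀ j ≠ 0} → Fin m → ℝ) |
        ∃ j, 1 ≤ |certVec σ p.1 ⬝ᵥ p.2 j|}
    rw [this]
    refine MeasurableSet.iUnion fun j => measurableSet_le measurable_const ?_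
    have := measurable_certVec (m := m) σ
    simp only [dotProduct]
    fun_prop
  set μ₁ := iidCols κ m ν
  set μ₂ := iidCols {j // ¬ x₀ j ≠ 0} m ν
  have hsplit := measurePreserving_piEquivPiSubtypeProd
    (fun _ : Fin n => Measure.pi fun _ : Fin m => ν) (fun j => x₀ j ≠ 0)
  set e := MeasurableEquiv.piEquivPiSubtypeProd (fun _ : Fin n => Fin m → ℝ) (fun j => x₀ j ≠ 0)
  change MeasurePreserving e (iidCols (Fin n) m ν) (μ₁.prod μ₂) at hsplit
  have hL : MeasurableSet {p : (κ → Fin m → ℝ) × ({j // ¬ x₀ j ≠ 0} → Fin m → ℝ) |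
      ¬ LinearIndependent ℝ p.1} := measurable_fst measurableSet_linearIndependent.compl
  have hsub : {ω | ¬ ExactRecovery (Φ ω) x₀} ⊆ (fun ω j i => Φ ω i j) ⁻¹'
      (e ⁻¹' ({p | ¬ LinearIndependent ℝ p.1} ∪ B)) := by
    intro ω hω
    by_contra hcon
    simp only [Set.mem_preimage, Set.mem_union, Set.mem_ofPred_eq, not_or, not_not] at hcon
    obtain ⟨hli, hb⟩ := hcon
    replace hb : ∀ j : {j // ¬ x₀ j ≠ 0}, |certVec σ (fun (j : κ) i => Φ ω i j) ⬝ᵥ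
        (fun i => Φ ω i j)| < 1 := fun j => lt_of_not_ge fun h => hb ⟨hli, j, h⟩
    refine hω (exactRecovery_of_dualCertificate hli
      (certVec σ fun (j : κ) i => Φ ω i j) (fun j hj => ?_) fun j hj => ?_)
    · exact certVec_dotProduct_col hli σ ⟨j, hj⟩
    · exact hb ⟨j, not_not.2 hj⟩
  calc P {ω | ¬ ExactRecovery (Φ ω) x₀}
      ≤ P ((fun ω j i => Φ ω i j) ⁻¹' (e ⁻¹' ({p | ¬ LinearIndependent ℝ p.1} ∪ B))) :=
        measure_mono hsub
    _ ≤ iidCols (Fin n) m ν (e ⁻¹' ({p | ¬ LinearIndependent ℝ p.1} ∪ B)) := by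
        rw [← map_columns hΦ]
        exact Measure.le_map_apply (aemeasurable_columns hΦ) _
    _ = (μ₁.prod μ₂) ({p | ¬ LinearIndependent ℝ p.1} ∪ B) :=
        hsplit.measure_preimage (hL.union hB).nullMeasurableSet
    _ ≤ (μ₁.prod μ₂) {p | ¬ LinearIndependent ℝ p.1} + (μ₁.prod μ₂) B := measure_union_le _ _
    _ ≤ _ := by
        gcongr
        · have : {p : (κ → Fin m → ℝ) × ({j // ¬ x₀ j ≠ 0} → Fin m → ℝ) |
              ¬ LinearIndependent ℝ p.1} = {c | ¬ LinearIndependent ℝ c} ×ˢ Set.univ := by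
            ext; simp
          rw [this, Measure.prod_prod, measure_univ, mul_one]
        · rw [Measure.prod_apply hB, ← lintegral_indicator measurableSet_linearIndependent]
          refine lintegral_mono fun c => ?_
          by_cases hc : LinearIndependent ℝ c
          · rw [Set.indicator_of_mem (by exact hc)]
            refine le_min prob_le_one ?_
            refine (measure_mono (t := {y | ∃ j, 1 ≤ |certVec σ c ⬝ᵥ y j|}) fun y hy => hy.2).trans
              ((measure_exists_one_le_abs_dotProduct_le hν _).trans ?_)
            apply ENNReal.ofReal_le_ofReal
            gcongr
            exact (Fintype.card_subtype_le _).trans (by simp)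
          · have : Prod.mk c ⁻¹' B = ∅ := by ext y; simp [B, hc]
            rw [this, measure_empty]
            exact zero_le

/-! ### Gaussian vectors: Laplace transforms, rotations, independence -/

theorem lintegral_pi_prod {ι : Type*} [Fintype ι] {X : ι → Type*} [∀ i, MeasurableSpace (X i)]
    (μ : ∀ i, Measure (X i)) [∀ i, IsProbabilityMeasure (μ i)] {f : ∀ i, X i → ℝ≥0∞}
    (hf : ∀ i, Measurable (f i)) :
    ∫⁻ x, ∏ i, f i (x i) ∂Measure.pi μ = ∏ i, ∫⁻ t, f i t ∂μ i := by
  have hind : iIndepFun (fun i (x : ∀ i, X i) => f i (x i)) (Measure.pi μ) :=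
    iIndepFun_pi fun i => (hf i).aemeasurable
  rw [lintegral_prod_eq_prod_lintegral_of_indepFun Finset.univ _ hind fun i =>
    (hf i).comp (measurable_pi_apply i)]
  refine Finset.prod_congr rfl fun i _ => ?_
  exact (measurePreserving_eval μ i).lintegral_comp (hf i)

theorem lintegral_exp_neg_mul_sq_gaussianReal {t : ℝ} (ht : 0 < 1 + 2 * t) :
    ∫⁻ x, ENNReal.ofReal (Real.exp (-(t * x ^ 2))) ∂gaussianReal 0 1 =
      ENNReal.ofReal ((1 + 2 * t) ^ (-(1 / 2) : ℝ)) := by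
  have hb : 0 < 1 / 2 + t := by linarith
  rw [gaussianReal_of_var_ne_zero _ one_ne_zero, lintegral_withDensity_eq_lintegral_mul _
    (measurable_gaussianPDF _ _) (by fun_prop)]
  have h1 : ∀ x : ℝ, (gaussianPDF 0 1 * fun x => ENNReal.ofReal (Real.exp (-(t * x ^ 2)))) x =
      ENNReal.ofReal ((√(2 * Real.pi))⁻¹ * Real.exp (-(1 / 2 + t) * x ^ 2)) := fun x => by
    rw [Pi.mul_apply, gaussianPDF, ← ENNReal.ofReal_mul (gaussianPDFReal_nonneg _ _ _)]
    simp only [gaussianPDFReal, NNReal.coe_one, mul_one, sub_zero]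
    rw [mul_assoc, ← Real.exp_add]
    congr 3
    ring
  simp_rw [h1]
  rw [← ofReal_integral_eq_lintegral_ofReal ((integrable_exp_neg_mul_sq hb).const_mul _)
    (ae_of_all _ fun x => by positivity), integral_const_mul, integral_gaussian]
  congr 1
  rw [Real.rpow_neg ht.le, ← Real.sqrt_eq_rpow, ← Real.sqrt_inv, ← Real.sqrt_inv,
    ← Real.sqrt_mul (by positivity)]
  congr 1
  field_simp

theorem measurePreserving_sum_orthonormalBasis {ι κ : Type*} [Fintype ι] [Fintype κ]
    (b : OrthonormalBasis ι ℝ (EuclideanSpace ℝ κ)) :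
    MeasurePreserving (fun (z : ι → ℝ) l => ∑ j, z j * b j l)
      (Measure.pi fun _ => gaussianReal 0 1) (Measure.pi fun _ => gaussianReal 0 1) := by
  refine ⟨by fun_prop, ?_⟩
  have h1 := stdGaussian_eq_map_pi_orthonormalBasis b
  rw [← map_pi_eq_stdGaussian] at h1
  have h2 := congrArg (Measure.map (WithLp.ofLp (p := 2) (V := κ → ℝ))) h1
  rw [Measure.map_map (by fun_prop) (by fun_prop), Measure.map_map (by fun_prop) (by fun_prop)] at h2
  have h3 : (WithLp.ofLp (p := 2) (V := κ → ℝ)) ∘ WithLp.toLp 2 = id := rfl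
  rw [h3, Measure.map_id] at h2
  conv_rhs => rw [h2]
  congr 1
  ext z l
  simp

theorem exists_orthonormalBasis_mem_orthogonal {m : ℕ} (W : Submodule ℝ (EuclideanSpace ℝ (Fin m)))
    {r : ℕ} (hW : Module.finrank ℝ W ≤ r) :
    ∃ (b : OrthonormalBasis (Fin m) ℝ (EuclideanSpace ℝ (Fin m))) (S : Finset (Fin m)),
      m ≤ S.card + r ∧ ∀ i ∈ S, b i ∈ Wᗮ := by
  set d := Module.finrank ℝ Wᗮ
  have hd : Module.finrank ℝ W + d = m := by
    simpa using W.finrank_add_finrank_orthogonal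
  let e := stdOrthonormalBasis ℝ Wᗮ
  let v : Fin m → EuclideanSpace ℝ (Fin m) := fun i =>
    if h : (i : ℕ) < d then (e ⟨i, h⟩ : EuclideanSpace ℝ (Fin m)) else 0
  let s : Set (Fin m) := {i | (i : ℕ) < d}
  have hv : Orthonormal ℝ (s.domRestrict v) := by
    have h1 : Orthonormal ℝ (fun i => (e i : EuclideanSpace ℝ (Fin m))) :=
      e.orthonormal.comp_linearIsometry Wᗮ.subtypeₗᵢ
    have h2 : s.domRestrict v = (fun i => (e i : EuclideanSpace ℝ (Fin m))) ∘
        fun i : s => (⟨i, i.2⟩ : Fin d) := by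
      ext1 i
      have hi : ((i : Fin m) : ℕ) < d := i.2
      simp [v, Set.domRestrict, hi]
    rw [h2]
    refine h1.comp _ fun i j hij => ?_
    have := congrArg Fin.val hij
    exact Subtype.ext (Fin.ext this)
  obtain ⟨b, hb⟩ := hv.exists_orthonormalBasis_extension_of_card_eq (by simp)
  refine ⟨b, Finset.univ.filter fun i => (i : ℕ) < d, ?_, fun i hi => ?_⟩
  · have hdm : d ≤ m := by omega
    rw [Fin.card_filter_val_lt, min_eq_right hdm]
    omega
  · have hi' : (i : ℕ) < d := (Finset.mem_filter.1 hi).2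
    rw [hb i hi']
    simp only [v, hi', dif_pos]
    exact (e ⟨i, hi'⟩).2

/-- In an orthonormal basis with at least `m - r` vectors orthogonal to `W`, the corresponding
coordinates of `y - w` do not depend on `w`, and the sum of their squares is at most `‖y - w‖²`.
They are independent standard Gaussians, so the integral factors. The alternative `F y = 0`
accommodates degenerate configurations. -/
theorem lintegral_gaussian_le_of_le_exp_neg_dist_sq {m r : ℕ}
    (W : Submodule ℝ (EuclideanSpace ℝ (Fin m))) (hW : Module.finrank ℝ W ≤ r) {a : ℝ} (ha : 0 ≤ a)
    {F : (Fin m → ℝ) → ℝ≥0∞} (hFm : Measurable F)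
    (hF : ∀ y, F y = 0 ∨ ∃ w ∈ W, F y ≤ ENNReal.ofReal (Real.exp (-(a * ‖WithLp.toLp 2 y - w‖ ^ 2)))) :
    ∫⁻ y, F y ∂(Measure.pi fun _ => gaussianReal 0 1) ≤
      ENNReal.ofReal ((1 + 2 * a) ^ (-(((m : ℝ) - r) / 2))) := by
  obtain ⟨b, S, hcard, hS⟩ := exists_orthonormalBasis_mem_orthogonal W hW
  rw [← (measurePreserving_sum_orthonormalBasis b).lintegral_comp hFm]
  have hle : ∀ z : Fin m → ℝ, F (fun l => ∑ j, z j * b j l) ≤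
      ∏ i, if i ∈ S then ENNReal.ofReal (Real.exp (-(a * z i ^ 2))) else 1 := by
    intro z
    rcases hF (fun l => ∑ j, z j * b j l) with h | ⟨w, hw, h⟩
    · rw [h]; exact zero_le
    · refine h.trans ?_
      set y : EuclideanSpace ℝ (Fin m) := WithLp.toLp 2 (fun l => ∑ j, z j * b j l)
      have hy : y = ∑ j, z j • b j := by ext l; simp [y]
      rw [Finset.prod_ite_mem, Finset.univ_inter, ← ENNReal.ofReal_prod_of_nonneg
        (fun i _ => (Real.exp_pos _).le), ← Real.exp_sum]
      apply ENNReal.ofReal_le_ofReal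
      apply Real.exp_le_exp.2
      rw [Finset.sum_neg_distrib, ← Finset.mul_sum]
      apply neg_le_neg
      apply mul_le_mul_of_nonneg_left _ ha
      have hcoord : ∀ i ∈ S, inner ℝ (b i) (y - w) = z i := fun i hi => by
        rw [inner_sub_right, (Submodule.mem_orthogonal' _ _).1 (hS i hi) w hw, sub_zero, hy]
        rw [b.orthonormal.inner_right_fintype]
      rw [← b.sum_sq_inner_right (y - w)]
      calc ∑ i ∈ S, z i ^ 2 = ∑ i ∈ S, inner ℝ (b i) (y - w) ^ 2 :=
            Finset.sum_congr rfl fun i hi => by rw [hcoord i hi]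
        _ ≤ _ := Finset.sum_le_univ_sum_of_nonneg fun i => sq_nonneg _
  refine (lintegral_mono hle).trans ?_
  rw [lintegral_pi_prod (fun _ : Fin m => gaussianReal 0 1)
    (f := fun i t => if i ∈ S then ENNReal.ofReal (Real.exp (-(a * t ^ 2))) else 1)
    (fun i => by split_ifs <;> fun_prop)]
  have hi : ∀ i, ∫⁻ t, (if i ∈ S then ENNReal.ofReal (Real.exp (-(a * t ^ 2))) else 1)
      ∂gaussianReal 0 1 = if i ∈ S then ENNReal.ofReal ((1 + 2 * a) ^ (-(1 / 2) : ℝ)) else 1 := by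
    intro i
    split_ifs
    · exact lintegral_exp_neg_mul_sq_gaussianReal (by linarith)
    · simp
  simp_rw [hi]
  rw [Finset.prod_ite_mem, Finset.univ_inter, Finset.prod_const, ← ENNReal.ofReal_pow
    (by positivity)]
  apply ENNReal.ofReal_le_ofReal
  rw [← Real.rpow_mul_natCast (by positivity)]
  apply Real.rpow_le_rpow_of_exponent_le (by linarith)
  have : (m : ℝ) ≤ S.card + r := by exact_mod_cast hcard
  linarith

theorem gaussian_submodule_eq_zero {m : ℕ} (W : Submodule ℝ (Fin m → ℝ))
    (hW : Module.finrank ℝ W < m) :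
    (Measure.pi fun _ : Fin m => gaussianReal 0 1) (W : Set (Fin m → ℝ)) = 0 := by
  have := nullSingletonClass_gaussianReal (μ := 0) one_ne_zero
  have hWm : MeasurableSet (W : Set (Fin m → ℝ)) := W.closed_of_finiteDimensional.measurableSet
  let e : (Fin m → ℝ) ≃ₗ[ℝ] EuclideanSpace ℝ (Fin m) :=
    (WithLp.linearEquiv 2 ℝ (Fin m → ℝ)).symm
  obtain ⟨b, S, hcard, hS⟩ := exists_orthonormalBasis_mem_orthogonal (W.map e.toLinearMap)
    (r := Module.finrank ℝ W) (LinearEquiv.finrank_map_eq e W).le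
  obtain ⟨i, hi⟩ : S.Nonempty := by rw [← Finset.card_pos]; omega
  rw [← (measurePreserving_sum_orthonormalBasis b).measure_preimage hWm.nullMeasurableSet]
  refine measure_mono_null (t := {z | z i = 0}) (fun z hz => ?_)
    (Measure.pi_hyperplane (fun _ : Fin m => gaussianReal 0 1) i 0)
  have hz' : e (fun l => ∑ j, z j * b j l) ∈ W.map e.toLinearMap :=
    Submodule.mem_map_of_mem hz
  have hy : e (fun l => ∑ j, z j * b j l) = ∑ j, z j • b j := by ext l; simp [e]
  have := (Submodule.mem_orthogonal' _ _).1 (hS i hi) _ hz'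
  rw [hy, b.orthonormal.inner_right_fintype] at this
  exact this

/-- Each row is a standard Gaussian vector, hence rotation invariant; transposing turns rows back
into columns. -/
theorem measurePreserving_rotate_columns {m : ℕ} {ι κ : Type*} [Fintype ι] [Fintype κ]
    (b : OrthonormalBasis ι ℝ (EuclideanSpace ℝ κ)) :
    MeasurePreserving (fun (c : ι → Fin m → ℝ) l i => ∑ j, c j i * b j l)
      (iidCols ι m (gaussianReal 0 1)) (iidCols κ m (gaussianReal 0 1)) := by
  have h1 := measurePreserving_transpose (κ := ι) (ι := Fin m) (gaussianReal 0 1)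
  have h2 := measurePreserving_pi (fun _ : Fin m => Measure.pi fun _ : ι => gaussianReal 0 1)
    (fun _ : Fin m => Measure.pi fun _ : κ => gaussianReal 0 1)
    fun _ => measurePreserving_sum_orthonormalBasis b
  have h3 := measurePreserving_transpose (κ := Fin m) (ι := κ) (gaussianReal 0 1)
  exact h3.comp (h2.comp h1)

/-- Inductively, a new Gaussian column almost surely avoids the span of fewer than `m` earlier ones,
a proper subspace. -/
theorem ae_linearIndependent_fin {m : ℕ} (k : ℕ) (hk : k ≤ m) :
    ∀ᵐ c ∂(iidCols (Fin k) m (gaussianReal 0 1)), LinearIndependent ℝ c := by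
  induction k with
  | zero => exact ae_of_all _ fun c => linearIndependent_empty_type
  | succ k ih =>
    have ih := ih (by omega)
    have hmp := (measurePreserving_piFinSuccAbove
      (fun _ : Fin (k + 1) => Measure.pi fun _ : Fin m => gaussianReal 0 1) 0).symm
    have hmeas : MeasurableSet {p : (Fin m → ℝ) × (Fin k → Fin m → ℝ) |
        LinearIndependent ℝ (Fin.cons p.1 p.2 : Fin (k + 1) → Fin m → ℝ)} := by
      refine measurableSet_linearIndependent.preimage (?_ : Measurable
        fun p : (Fin m → ℝ) × (Fin k → Fin m → ℝ) => (Fin.cons p.1 p.2 : Fin (k + 1) → Fin m → ℝ))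
      refine measurable_pi_lambda _ fun j => ?_
      refine Fin.cases ?_ (fun j => ?_) j
      · simpa using measurable_fst
      · simpa [Function.comp_def] using (measurable_pi_apply j).comp measurable_snd
    have hprod : ∀ᵐ p ∂((Measure.pi fun _ : Fin m => gaussianReal 0 1).prod
        (iidCols (Fin k) m (gaussianReal 0 1))),
        LinearIndependent ℝ (Fin.cons p.1 p.2 : Fin (k + 1) → Fin m → ℝ) := by
      rw [Measure.ae_prod_iff_ae_ae hmeas, Measure.ae_ae_comm hmeas]
      filter_upwards [ih] with c hc
      have hspan : Module.finrank ℝ (Submodule.span ℝ (Set.range c)) < m := by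
        rw [finrank_span_eq_card hc, Fintype.card_fin]
        omega
      filter_upwards [measure_eq_zero_iff_ae_notMem.1 (gaussian_submodule_eq_zero _ hspan)]
        with x hx
      exact linearIndependent_finCons.2 ⟨hc, hx⟩
    change ∀ᵐ c ∂(Measure.pi fun _ : Fin (k + 1) => Measure.pi fun _ : Fin m => gaussianReal 0 1),
      LinearIndependent ℝ c
    rw [← hmp.map_eq, ae_map_iff hmp.measurable.aemeasurable measurableSet_linearIndependent]
    filter_upwards [hprod] with p hp
    simpa [MeasurableEquiv.piFinSuccAbove, Fin.insertNthEquiv] using hp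

theorem ae_linearIndependent {m : ℕ} {κ : Type*} [Fintype κ] (hk : Fintype.card κ ≤ m) :
    ∀ᵐ c ∂(iidCols κ m (gaussianReal 0 1)), LinearIndependent ℝ c := by
  let e := (Fintype.equivFin κ).symm
  have hmp := measurePreserving_piCongrLeft
    (fun _ : κ => Measure.pi fun _ : Fin m => gaussianReal 0 1) e
  have h := ae_linearIndependent_fin _ hk
  unfold iidCols at h ⊢
  rw [← hmp.map_eq, ae_map_iff hmp.measurable.aemeasurable measurableSet_linearIndependent]
  filter_upwards [h] with c hc
  rw [← linearIndependent_equiv e]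
  convert hc using 1
  ext j i
  simp [MeasurableEquiv.coe_piCongrLeft]

/-! ### Gaussian case: the norm of the certificate -/

/-- In rotated columns the certificate is `∑ u j • c' j`, and its coefficient along `σ/√k` is `u j₀
= τ/√k` with `τ = ‖q‖²`. Dividing by `u j₀` leaves `c' j₀` minus a vector of the other span, of
squared norm `τ/(τ²/k) = k/τ`. -/
theorem exp_neg_div_certVec_le {m : ℕ} {κ : Type*} [Fintype κ] [DecidableEq κ] [Nonempty κ]
    {σ : κ → ℝ} (hσ : ∀ j, |σ j| = 1) (b : OrthonormalBasis κ ℝ (EuclideanSpace ℝ κ)) (j₀ : κ)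
    (hb : b j₀ = (√(Fintype.card κ))⁻¹ • WithLp.toLp 2 σ) (c' : κ → Fin m → ℝ)
    (hc : LinearIndependent ℝ fun l i => ∑ j, c' j i * b j l) :
    ∃ w ∈ Submodule.span ℝ ((fun j => WithLp.toLp 2 (c' j)) '' {j | j ≠ j₀}),
      ‖WithLp.toLp 2 (c' j₀) - w‖ ^ 2 = Fintype.card κ /
        (certVec σ (fun l i => ∑ j, c' j i * b j l) ⬝ᵥ
          certVec σ (fun l i => ∑ j, c' j i * b j l)) := by
  set c : κ → Fin m → ℝ := fun l i => ∑ j, c' j i * b j l with hcdef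
  set k : ℝ := (Fintype.card κ : ℝ)
  have hk : 0 < k := by simp [k, Fintype.card_pos]
  have hτpos := certVec_dotProduct_self_pos (σ := σ) hc fun j h => by simpa [h] using hσ j
  have hτ' := certVec_dotProduct_self hc σ
  set τ := certVec σ c ⬝ᵥ certVec σ c with hτ
  let u : κ → ℝ := fun j => ∑ l, certCoef σ c l * b j l
  have hu : u j₀ = τ / √k := by
    simp only [u, hb]
    rw [hτ', dotProduct, Finset.sum_div]
    refine Finset.sum_congr rfl fun l _ => ?_
    simp [div_eq_mul_inv]; ring
  have hq : (WithLp.toLp 2 (certVec σ c) : EuclideanSpace ℝ (Fin m)) =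
      ∑ j, u j • WithLp.toLp 2 (c' j) := by
    ext i
    simp only [certVec, Matrix.vecMul, dotProduct, Matrix.of_apply, hcdef, u, WithLp.ofLp_sum,
      WithLp.ofLp_smul, Finset.sum_apply, Pi.smul_apply, smul_eq_mul, Finset.sum_mul,
      Finset.mul_sum]
    rw [Finset.sum_comm]
    refine Finset.sum_congr rfl fun j _ => Finset.sum_congr rfl fun l _ => by ring
  have hsk : 0 < √k := Real.sqrt_pos.2 hk
  have hu0 : u j₀ ≠ 0 := by rw [hu]; positivity
  refine ⟨-((u j₀)⁻¹ • ∑ j ∈ Finset.univ.erase j₀, u j • WithLp.toLp 2 (c' j)), ?_, ?_⟩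
  · refine Submodule.neg_mem _ (Submodule.smul_mem _ _ (Submodule.sum_mem _ fun j hj => ?_))
    exact Submodule.smul_mem _ _ (Submodule.subset_span ⟨j, (Finset.mem_erase.1 hj).1, rfl⟩)
  · have h1 : WithLp.toLp 2 (c' j₀) - -((u j₀)⁻¹ • ∑ j ∈ Finset.univ.erase j₀,
        u j • WithLp.toLp 2 (c' j)) =
        (u j₀)⁻¹ • (WithLp.toLp 2 (certVec σ c) : EuclideanSpace ℝ (Fin m)) := by
      rw [hq, ← Finset.add_sum_erase _ _ (Finset.mem_univ j₀), smul_add, smul_smul,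
        inv_mul_cancel₀ hu0, one_smul, sub_neg_eq_add]
    have h2 : ‖(WithLp.toLp 2 (certVec σ c) : EuclideanSpace ℝ (Fin m))‖ ^ 2 = τ := by
      rw [EuclideanSpace.real_norm_sq_eq, hτ, dotProduct]
      exact Finset.sum_congr rfl fun i _ => sq _
    rw [h1, norm_smul, mul_pow, h2, hu, norm_inv, Real.norm_eq_abs, inv_pow, sq_abs, div_pow,
      Real.sq_sqrt hk.le]
    field_simp

theorem lintegral_exp_neg_div_certVec_le {m : ℕ} {κ : Type*} [Fintype κ] [DecidableEq κ]
    [Nonempty κ] {σ : κ → ℝ} (hσ : ∀ j, |σ j| = 1) {a : ℝ} (ha : 0 ≤ a) :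
    ∫⁻ c in {c | LinearIndependent ℝ c}, ENNReal.ofReal (Real.exp
      (-(a / (certVec σ c ⬝ᵥ certVec σ c)))) ∂(iidCols κ m (gaussianReal 0 1)) ≤
      ENNReal.ofReal ((1 + 2 * (a / Fintype.card κ)) ^
        (-(((m : ℝ) - (Fintype.card κ - 1 : ℕ)) / 2))) := by
  set k : ℝ := (Fintype.card κ : ℝ) with hkdef
  have hk : 0 < k := by simp [k, Fintype.card_pos]
  obtain ⟨j₀⟩ := ‹Nonempty κ›
  have hnorm : ‖(WithLp.toLp 2 σ : EuclideanSpace ℝ κ)‖ = √k := by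
    rw [EuclideanSpace.norm_eq]
    simp [hσ, k]
  obtain ⟨b, hb⟩ : ∃ b : OrthonormalBasis κ ℝ (EuclideanSpace ℝ κ),
      b j₀ = (√k)⁻¹ • WithLp.toLp 2 σ := by
    obtain ⟨b, hb⟩ := Orthonormal.exists_orthonormalBasis_extension_of_card_eq (𝕜 := ℝ)
      (E := EuclideanSpace ℝ κ) (ι := κ) (by simp)
      (v := fun _ => (√k)⁻¹ • WithLp.toLp 2 σ) (s := {j₀}) (by
        refine ⟨fun i => ?_, fun i j hij => absurd (Subsingleton.elim i j) hij⟩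
        simp only [Set.domRestrict]
        rw [norm_smul, hnorm, norm_inv, Real.norm_of_nonneg (Real.sqrt_nonneg _),
          inv_mul_cancel₀ (Real.sqrt_pos.2 hk).ne'])
    exact ⟨b, hb j₀ rfl⟩
  set F : (κ → Fin m → ℝ) → ℝ≥0∞ := Set.indicator {c | LinearIndependent ℝ c} fun c =>
    ENNReal.ofReal (Real.exp (-(a / (certVec σ c ⬝ᵥ certVec σ c)))) with hFdef
  have hF : Measurable F := by
    refine Measurable.indicator ?_ measurableSet_linearIndependent
    have := measurable_certVec (m := m) σ
    simp only [dotProduct]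
    fun_prop
  rw [← lintegral_indicator measurableSet_linearIndependent, ← hFdef,
    ← (measurePreserving_rotate_columns b).lintegral_comp hF]
  have hS := (measurePreserving_rotate_columns (m := m) b).measurable
  set S : (κ → Fin m → ℝ) → κ → Fin m → ℝ := fun c l i => ∑ j, c j i * b j l with hSdef
  set C := ENNReal.ofReal ((1 + 2 * (a / k)) ^ (-(((m : ℝ) - (Fintype.card κ - 1 : ℕ)) / 2)))
  -- Integrating over column `j₀` alone, with the others frozen, already gives a bound independent
  -- of them. Their span has dimension at most `k - 1`.
  refine (lintegral_le_of_lmarginal_le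
    (μ := fun _ : κ => Measure.pi fun _ : Fin m => gaussianReal 0 1) {j₀} (hF.comp hS) (measurable_const (a := C)) ?_).trans (by simp)
  intro c'
  rw [lmarginal_singleton, lmarginal_singleton]
  simp only [Function.comp_apply, lintegral_const, measure_univ, mul_one]
  refine lintegral_gaussian_le_of_le_exp_neg_dist_sq
    (Submodule.span ℝ ((fun j => WithLp.toLp 2 (c' j)) '' {j | j ≠ j₀})) ?_ (by positivity)
    ((hF.comp hS).comp (measurable_update c')) fun y => ?_
  · classical
    have hfin : ((fun j => (WithLp.toLp 2 (c' j) : EuclideanSpace ℝ (Fin m))) '' {j | j ≠ j₀}) =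
        ((Finset.univ.erase j₀).image fun j => WithLp.toLp 2 (c' j) : Finset _) := by
      ext; simp
    rw [hfin]
    refine (finrank_span_finset_le_card _).trans (Finset.card_image_le.trans ?_)
    rw [Finset.card_erase_of_mem (Finset.mem_univ _), Finset.card_univ]
  · by_cases hli : LinearIndependent ℝ (S (Function.update c' j₀ y))
    · right
      obtain ⟨w, hw, h⟩ := exp_neg_div_certVec_le hσ b j₀ hb (Function.update c' j₀ y) hli
      rw [Function.update_self] at h
      refine ⟨w, ?_, ?_⟩
      · convert hw using 2
        refine Set.image_congr fun j hj => ?_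
        rw [Function.update_of_ne hj]
      · rw [h, hFdef, Set.indicator_of_mem (by exact hli)]
        apply ENNReal.ofReal_le_ofReal
        apply Real.exp_le_exp.2
        apply le_of_eq
        simp only [hSdef, ← hkdef]
        field_simp
    · left
      exact Set.indicator_of_notMem (by exact hli) _

/-! ### Rescaling and passage to complements -/

theorem exactRecovery_smul_iff {m n : ℕ} {Φ : Matrix (Fin m) (Fin n) ℝ} {x₀ : Fin n → ℝ} {r : ℝ}
    (hr : r ≠ 0) : ExactRecovery (r • Φ) x₀ ↔ ExactRecovery Φ x₀ := by
  simp only [ExactRecovery, Matrix.smul_mulVec, smul_right_inj hr]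

theorem exactRecovery_zero {m n : ℕ} (Φ : Matrix (Fin m) (Fin n) ℝ) : ExactRecovery Φ 0 := by
  intro x _ hx
  obtain ⟨j, hj⟩ := Function.ne_iff.1 hx
  simp only [l1Norm, Pi.zero_apply, abs_zero, Finset.sum_const_zero]
  exact Finset.sum_pos' (fun i _ => abs_nonneg _) ⟨j, Finset.mem_univ _, abs_pos.2 hj⟩

theorem HasIIDEntries.const_smul {Ω : Type*} [MeasurableSpace Ω] {P : Measure Ω} {m n : ℕ}
    {Φ : Ω → Matrix (Fin m) (Fin n) ℝ} {ν : Measure ℝ} (h : HasIIDEntries Φ ν P) (r : ℝ) :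
    HasIIDEntries (fun ω => r • Φ ω) (ν.map (r * ·)) P where
  indep := h.indep.comp (fun _ x => r * x) fun _ => measurable_const_mul r
  law i j := by
    have hl := h.law i j
    refine ⟨hl.aemeasurable.const_mul r, ?_⟩
    rw [← hl.map_eq, AEMeasurable.map_map_of_aemeasurable
      (measurable_const_mul r).aemeasurable hl.aemeasurable]
    rfl

theorem card_support_le {n s : ℕ} {x₀ : Fin n → ℝ} (h : IsSparse s x₀) :
    Fintype.card {j // x₀ j ≠ 0} ≤ s := by
  rw [Fintype.card_subtype]
  exact h

/-- Subadditivity suffices, so measurability of the recovery event is not needed. -/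
theorem one_sub_le_measureReal_exactRecovery {Ω : Type*} [MeasurableSpace Ω] {P : Measure Ω}
    [IsProbabilityMeasure P] {m n : ℕ} {Φ : Ω → Matrix (Fin m) (Fin n) ℝ} {x₀ : Fin n → ℝ}
    {p : ℝ} (hp : 0 ≤ p) (h : P {ω | ¬ ExactRecovery (Φ ω) x₀} ≤ ENNReal.ofReal p) :
    1 - p ≤ P.real {ω | ExactRecovery (Φ ω) x₀} := by
  have h1 : P.real {ω | ¬ ExactRecovery (Φ ω) x₀} ≤ p := ENNReal.toReal_le_of_le_ofReal hp h
  have h2 : P.real Set.univ ≤ P.real {ω | ExactRecovery (Φ ω) x₀} +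
      P.real {ω | ¬ ExactRecovery (Φ ω) x₀} := by
    refine (measureReal_mono fun ω _ => ?_).trans (measureReal_union_le _ _)
    exact em (ExactRecovery (Φ ω) x₀)
  rw [probReal_univ] at h2
  linarith

/-! ### Gaussian case: the exponent and the conclusion -/

theorem min_one_two_mul_le_two_mul_rpow {z θ : ℝ} (hz : 0 ≤ z) (hθ : 0 ≤ θ) (hθ1 : θ ≤ 1) :
    min 1 (2 * z) ≤ 2 * z ^ θ := by
  rcases le_total z 1 with h | h
  · refine (min_le_right _ _).trans ?_
    have := Real.rpow_le_rpow_of_exponent_ge_of_imp hz h hθ1 (fun h0 h1 => by linarith)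
    rw [Real.rpow_one] at this
    linarith
  · refine (min_le_left _ _).trans ?_
    have := Real.one_le_rpow h hθ
    linarith

theorem sub_sq_div_two_le_log_one_add {x : ℝ} (hx : 0 ≤ x) : x - x ^ 2 / 2 ≤ Real.log (1 + x) := by
  refine le_trans ?_ (Real.le_log_one_add_of_nonneg hx)
  rw [le_div_iff₀ (by linarith)]
  nlinarith [pow_nonneg hx 3]

theorem exists_le_recoveryExponent {β : ℝ} {s : ℕ} (hβ : 1 < β) (hs : 0 < s) :
    ∃ θ : ℝ, 0 ≤ θ ∧ θ ≤ 1 ∧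
      recoveryExponent β s ≤ β * s * (θ / s - (θ / s) ^ 2 / 2) - θ := by
  have hs' : (0 : ℝ) < s := by exact_mod_cast hs
  have hq2 : 0 < β / (2 * s) := by positivity
  set p := √(β / (2 * s) + β - 1) with hp
  set q := √(β / (2 * s)) with hq
  have hp' : p ^ 2 = β / (2 * s) + β - 1 := Real.sq_sqrt (by linarith)
  have hq' : q ^ 2 = β / (2 * s) := Real.sq_sqrt hq2.le
  have hq0 : 0 < q := Real.sqrt_pos.2 hq2
  have hqp : q ≤ p := Real.sqrt_le_sqrt (by linarith)
  have hp0 : 0 < p := hq0.trans_le hqp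
  -- The right side equals `(p² - q²)θ - q²θ²`. With `θ = 1 - q/p` it exceeds `(p - q)² = (pθ)²` by
  -- exactly `p²θ³(1 - θ) ≥ 0`; this need not be the optimal `θ`, but it lies in `[0, 1]`.
  refine ⟨(p - q) / p, div_nonneg (by linarith) hp0.le, (div_le_one hp0).2 (by linarith), ?_⟩
  have hδ : β - 1 = p ^ 2 - q ^ 2 := by linarith
  set θ := (p - q) / p with hθ
  have h1 : β * s * (θ / s - (θ / s) ^ 2 / 2) - θ = (p ^ 2 - q ^ 2) * θ - q ^ 2 * θ ^ 2 := by
    rw [← hδ, hq']; field_simp; ring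
  have hpθ : p * θ = p - q := by rw [hθ]; field_simp
  have hθ0 : 0 ≤ θ := div_nonneg (by linarith) hp0.le
  have hf : recoveryExponent β s = (p - q) ^ 2 := rfl
  rw [h1, hf, ← hpθ]
  have hqe : q = p - p * θ := by linarith
  have hθ1 : θ ≤ 1 := (div_le_one hp0).2 (by linarith)
  have : (p ^ 2 - q ^ 2) * θ - q ^ 2 * θ ^ 2 - (p * θ) ^ 2 = p ^ 2 * (θ ^ 3 * (1 - θ)) := by
    rw [hqe]; ring
  have h3 : 0 ≤ p ^ 2 * (θ ^ 3 * (1 - θ)) := by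
    have := sub_nonneg.2 hθ1
    positivity
  linarith

theorem rpow_mul_rpow_le_rpow_neg_recoveryExponent {n s k : ℕ} {β θ D : ℝ} (hn : 0 < n)
    (hβ : 1 < β) (hk : 0 < k) (hks : k ≤ s) (hθ : 0 ≤ θ)
    (hf : recoveryExponent β s ≤ β * s * (θ / s - (θ / s) ^ 2 / 2) - θ)
    (hD : 2 * β * s * Real.log n ≤ D) :
    (n : ℝ) ^ θ * (1 + θ / k) ^ (-(D / 2)) ≤ (n : ℝ) ^ (-recoveryExponent β s) := by
  have hn' : (0 : ℝ) < n := by exact_mod_cast hn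
  have hk' : (0 : ℝ) < k := by exact_mod_cast hk
  have hks' : (k : ℝ) ≤ s := by exact_mod_cast hks
  have hs' : (0 : ℝ) < s := hk'.trans_le hks'
  have hL : 0 ≤ Real.log n := Real.log_natCast_nonneg n
  have hx : 0 ≤ θ / s := by positivity
  have hxk : θ / s ≤ θ / k := div_le_div_of_nonneg_left hθ hk' hks'
  have hpos : 0 < 1 + θ / k := by linarith
  rw [Real.rpow_def_of_pos hn', Real.rpow_def_of_pos hn', Real.rpow_def_of_pos hpos,
    ← Real.exp_add, Real.exp_le_exp]
  have h1 : θ / s - (θ / s) ^ 2 / 2 ≤ Real.log (1 + θ / k) :=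
    (sub_sq_div_two_le_log_one_add hx).trans (Real.log_le_log (by linarith) (by linarith))
  have h2 : 0 ≤ Real.log (1 + θ / k) := Real.log_nonneg (by linarith)
  have hLs : 0 ≤ β * s * Real.log n := by positivity
  have h3 : (β * s * Real.log n) * (θ / s - (θ / s) ^ 2 / 2) ≤
      (D / 2) * Real.log (1 + θ / k) :=
    (mul_le_mul_of_nonneg_left h1 hLs).trans (mul_le_mul_of_nonneg_right (by linarith) h2)
  have h4 := mul_le_mul_of_nonneg_left hf hL
  nlinarith

theorem hasSubgaussianMGF_id_gaussianReal : HasSubgaussianMGF id 1 (gaussianReal 0 1) where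
  integrable_exp_mul t := integrable_exp_mul_gaussianReal t
  mgf_le t := by
    rw [mgf_id_gaussianReal]
    simp

theorem IsGaussianMap.sqrt_smul {Ω : Type*} [MeasurableSpace Ω] {P : Measure Ω} {m n : ℕ}
    {Φ : Ω → Matrix (Fin m) (Fin n) ℝ} (h : IsGaussianMap Φ P) (hm : 0 < m) :
    HasIIDEntries (fun ω => √m • Φ ω) (gaussianReal 0 1) P := by
  have := HasIIDEntries.const_smul h (√m)
  rw [gaussianReal_map_const_mul, mul_zero] at this
  convert this
  apply NNReal.eq
  have hm' : (m : ℝ) ≠ 0 := by exact_mod_cast hm.ne'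
  push_cast
  change _ = √m ^ 2 * _
  rw [Real.sq_sqrt (Nat.cast_nonneg m)]
  field_simp

theorem measure_not_exactRecovery_gaussian_le {Ω : Type*} [MeasurableSpace Ω] {P : Measure Ω}
    [IsProbabilityMeasure P] {n m s : ℕ} {β : ℝ} {x₀ : Fin n → ℝ}
    {Φ : Ω → Matrix (Fin m) (Fin n) ℝ} (hn : 0 < n) (hs : 0 < s) (hβ : 1 < β)
    (hx₀ : IsSparse s x₀) (hΦ : HasIIDEntries Φ (gaussianReal 0 1) P)
    (hm : 2 * β * s * Real.log n + s ≤ (m : ℝ)) [Nonempty {j // x₀ j ≠ 0}] :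
    P {ω | ¬ ExactRecovery (Φ ω) x₀} ≤
      ENNReal.ofReal (2 * (n : ℝ) ^ (-recoveryExponent β s)) := by
  obtain ⟨θ, hθ0, hθ1, hf⟩ := exists_le_recoveryExponent hβ hs
  have hL : 0 ≤ Real.log n := Real.log_natCast_nonneg n
  have hks := card_support_le hx₀
  set k := Fintype.card {j // x₀ j ≠ 0} with hk
  have hkpos : 0 < k := Fintype.card_pos
  have hks' : (k : ℝ) ≤ s := by exact_mod_cast hks
  have hpos : 0 ≤ 2 * β * s * Real.log n := by positivity
  have hkm : k ≤ m := by
    have : (k : ℝ) ≤ m := by linarith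
    exact_mod_cast this
  refine (measure_not_exactRecovery_le hasSubgaussianMGF_id_gaussianReal hΦ x₀).trans ?_
  have hli : iidCols {j // x₀ j ≠ 0} m (gaussianReal 0 1) {c | ¬ LinearIndependent ℝ c} = 0 :=
    ae_iff.1 (ae_linearIndependent hkm)
  rw [hli, zero_add]
  have hn0 : (0 : ℝ) ≤ 2 * (n : ℝ) ^ θ := by positivity
  calc _ ≤ ∫⁻ c in {c | LinearIndependent ℝ c}, ENNReal.ofReal (2 * (n : ℝ) ^ θ) *
        ENNReal.ofReal (Real.exp (-((θ / 2) / (certVec (supportSign x₀) c ⬝ᵥ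
          certVec (supportSign x₀) c)))) ∂(iidCols {j // x₀ j ≠ 0} m (gaussianReal 0 1)) := by
        refine lintegral_mono fun c => ?_
        rw [← ENNReal.ofReal_one, ← ENNReal.ofReal_min, ← ENNReal.ofReal_mul hn0]
        apply ENNReal.ofReal_le_ofReal
        rw [mul_assoc]
        refine (min_one_two_mul_le_two_mul_rpow (by positivity) hθ0 hθ1).trans (le_of_eq ?_)
        rw [Real.mul_rpow (by positivity) (Real.exp_pos _).le, ← Real.exp_mul, mul_assoc]
        congr 3
        ring_nf
    _ = ENNReal.ofReal (2 * (n : ℝ) ^ θ) * _ := lintegral_const_mul' _ _ ENNReal.ofReal_ne_top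
    _ ≤ ENNReal.ofReal (2 * (n : ℝ) ^ θ) * ENNReal.ofReal
        ((1 + 2 * (θ / 2 / k)) ^ (-(((m : ℝ) - (k - 1 : ℕ)) / 2))) :=
        mul_le_mul_right (lintegral_exp_neg_div_certVec_le (abs_supportSign x₀) (by positivity)) _
    _ ≤ _ := by
        rw [← ENNReal.ofReal_mul hn0]
        apply ENNReal.ofReal_le_ofReal
        rw [mul_assoc]
        apply mul_le_mul_of_nonneg_left _ zero_le_two
        refine le_trans (le_of_eq ?_) (rpow_mul_rpow_le_rpow_neg_recoveryExponent hn hβ hkpos hks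
          hθ0 hf (D := (m : ℝ) - (k - 1 : ℕ)) ?_)
        · congr 3
          ring
        -- The summand `s` in the hypothesis on `m` pays for the `k - 1` lost dimensions.
        · rw [Nat.cast_pred hkpos]
          linarith

/-! ### Nets and quadratic forms -/

/-- A `1/2`-separated subset of the sphere of maximal size is a net. Doubling it gives a 1-separated
set in the ball of radius 2, and the Besicovitch volume count applies. -/
theorem exists_half_net_unitSphere (E : Type*) [NormedAddCommGroup E] [NormedSpace ℝ E]
    [FiniteDimensional ℝ E] :
    ∃ N : Finset E, N.card ≤ 5 ^ Module.finrank ℝ E ∧ (∀ v ∈ N, ‖v‖ = 1) ∧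
      ∀ v : E, ‖v‖ = 1 → ∃ w ∈ N, ‖v - w‖ ≤ 1 / 2 := by
  classical
  let Sep : Finset E → Prop := fun N =>
    (∀ v ∈ N, ‖v‖ = 1) ∧ ∀ v ∈ N, ∀ w ∈ N, v ≠ w → 1 / 2 ≤ ‖v - w‖
  have hbound : ∀ N, Sep N → N.card ≤ 5 ^ Module.finrank ℝ E := fun N hN => by
    have hinj : Function.Injective fun v : E => (2 : ℝ) • v := smul_right_injective E two_ne_zero
    rw [← Finset.card_image_of_injective N hinj]
    refine Besicovitch.card_le_of_separated _ (fun c hc => ?_) fun c hc d hd hcd => ?_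
    · obtain ⟨v, hv, rfl⟩ := Finset.mem_image.1 hc
      rw [norm_smul, hN.1 v hv]; simp
    · obtain ⟨v, hv, rfl⟩ := Finset.mem_image.1 hc
      obtain ⟨w, hw, rfl⟩ := Finset.mem_image.1 hd
      have := hN.2 v hv w hw fun h => hcd (by rw [h])
      simp only [← smul_sub, norm_smul, Real.norm_ofNat]
      linarith
  let T : Set ℕ := {k | ∃ N, Sep N ∧ N.card = k}
  have hT : T.Nonempty := ⟨0, ∅, ⟨by simp, by simp⟩, rfl⟩
  have hTb : BddAbove T := ⟨_, by rintro _ ⟨N, hN, rfl⟩; exact hbound N hN⟩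
  obtain ⟨N, hN, hcard⟩ := Nat.sSup_mem hT hTb
  refine ⟨N, hbound N hN, hN.1, fun v hv => ?_⟩
  by_contra! hcon
  have hvN : v ∉ N := fun h => by have := hcon v h; norm_num at this
  have hSep : Sep (insert v N) := by
    refine ⟨fun w hw => ?_, fun w hw z hz hwz => ?_⟩
    · rcases Finset.mem_insert.1 hw with rfl | h
      exacts [hv, hN.1 w h]
    · rcases Finset.mem_insert.1 hw with rfl | hw' <;> rcases Finset.mem_insert.1 hz with rfl | hz'
      · exact absurd rfl hwz
      · exact (hcon z hz').le
      · rw [norm_sub_rev]; exact (hcon _ ‹_›).le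
      · exact hN.2 w hw' z hz' hwz
  have := le_csSup hTb (show (insert v N).card ∈ T from ⟨_, hSep, rfl⟩)
  rw [Finset.card_insert_of_notMem hvN, hcard] at this
  omega

theorem abs_norm_sq_sub_le_of_net {E F : Type*} [NormedAddCommGroup E] [InnerProductSpace ℝ E]
    [FiniteDimensional ℝ E] [NormedAddCommGroup F] [InnerProductSpace ℝ F] (S : E →ₗ[ℝ] F) (a : ℝ)
    {N : Finset E} (hN1 : ∀ v ∈ N, ‖v‖ = 1)
    (hN : ∀ v : E, ‖v‖ = 1 → ∃ w ∈ N, ‖v - w‖ ≤ 1 / 2) {D : ℝ}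
    (hD : ∀ w ∈ N, |‖S w‖ ^ 2 - a| ≤ D) (v : E) : |‖S v‖ ^ 2 - a * ‖v‖ ^ 2| ≤ 32 * D * ‖v‖ ^ 2 := by
  set Q : E → ℝ := fun v => ‖S v‖ ^ 2 - a * ‖v‖ ^ 2 with hQ
  have hScont : Continuous S := S.continuous_of_finiteDimensional
  have hQc : Continuous Q := by fun_prop
  have hhom : ∀ (t : ℝ) v, Q (t • v) = t ^ 2 * Q v := fun t v => by
    simp only [hQ, map_smul, norm_smul, Real.norm_eq_abs, mul_pow, sq_abs]; ring
  rcases eq_or_ne v 0 with rfl | hv0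
  · simp
  have hne : (Metric.sphere (0 : E) 1).Nonempty :=
    ⟨(‖v‖⁻¹ : ℝ) • v, by simp [norm_smul, norm_ne_zero_iff.2 hv0]⟩
  obtain ⟨z, hz, hzmax⟩ := (isCompact_sphere (0 : E) 1).exists_isMaxOn hne hQc.abs.continuousOn
  have hz1 : ‖z‖ = 1 := by simpa using hz
  set M := |Q z| with hM
  have hall : ∀ v, |Q v| ≤ M * ‖v‖ ^ 2 := by
    intro v
    rcases eq_or_ne v 0 with rfl | hv0
    · simp [hQ]
    have hv : 0 < ‖v‖ := norm_pos_iff.2 hv0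
    have h1 : |Q ((‖v‖⁻¹ : ℝ) • v)| ≤ M := hzmax (by simp [norm_smul, hv.ne'])
    rw [hhom, abs_mul, abs_of_nonneg (sq_nonneg _), inv_pow] at h1
    rwa [inv_mul_le_iff₀ (by positivity), mul_comm] at h1
  obtain ⟨w, hw, hzw⟩ := hN z hz1
  have hw1 := hN1 w hw
  set x := z - w with hx
  set y := z + w with hy
  have hxy : ‖y‖ ^ 2 = 4 - ‖x‖ ^ 2 := by
    have := parallelogram_law_with_norm ℝ z w
    rw [← hx, ← hy, hz1, hw1] at this
    linarith
  -- Polarization of `Q z - Q w = B(x, y) = B(2x, y/2)`. The weights balance the short `x` against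
  -- the long `y`: the two squared norms add up to at most `31/8`, so the difference is at most
  -- `31/32` of the maximum `M`, whence `M ≤ 32 D`.
  have hdiff : Q z - Q w = (Q ((2 : ℝ) • x + (1 / 2 : ℝ) • y) - Q ((2 : ℝ) • x - (1 / 2 : ℝ) • y)) / 4 := by
    simp only [hQ, map_add, map_sub, map_smul, hx, hy]
    simp only [← real_inner_self_eq_norm_sq, inner_add_left, inner_add_right, inner_sub_left,
      inner_sub_right, real_inner_smul_left, real_inner_smul_right,
      real_inner_comm z w, real_inner_comm (S z) (S w)]
    ring
  have hpar := parallelogram_law_with_norm ℝ ((2 : ℝ) • x) ((1 / 2 : ℝ) • y)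
  have h1 := hall ((2 : ℝ) • x + (1 / 2 : ℝ) • y)
  have h2 := hall ((2 : ℝ) • x - (1 / 2 : ℝ) • y)
  simp only [norm_smul, Real.norm_ofNat, norm_div, norm_one] at hpar
  have hsum : ‖(2 : ℝ) • x + (1 / 2 : ℝ) • y‖ ^ 2 + ‖(2 : ℝ) • x - (1 / 2 : ℝ) • y‖ ^ 2 =
      8 * ‖x‖ ^ 2 + ‖y‖ ^ 2 / 2 := by linarith
  have hx4 : ‖x‖ ^ 2 ≤ 1 / 4 := by nlinarith [norm_nonneg x]
  have hM0 : 0 ≤ M := abs_nonneg _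
  have hQw : |Q w| ≤ D := by simpa [hQ, hw1] using hD w hw
  have hfin : |Q z - Q w| ≤ 31 / 32 * M := by
    rw [hdiff, abs_div, abs_of_pos (by norm_num : (0 : ℝ) < 4)]
    have := abs_sub (Q ((2 : ℝ) • x + (1 / 2 : ℝ) • y)) (Q ((2 : ℝ) • x - (1 / 2 : ℝ) • y))
    have h3 : M * ‖(2 : ℝ) • x + (1 / 2 : ℝ) • y‖ ^ 2 + M * ‖(2 : ℝ) • x - (1 / 2 : ℝ) • y‖ ^ 2 ≤
        31 / 8 * M := by
      rw [← mul_add, hsum, hxy]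
      nlinarith
    linarith
  have hMD : M ≤ 32 * D := by
    have := abs_sub_abs_le_abs_sub (Q z) (Q w)
    linarith
  exact (hall v).trans (mul_le_mul_of_nonneg_right hMD (sq_nonneg _))

/-! ### Concentration for sums of squares of subgaussian variables -/

section Moment
variable {Ω : Type*} [MeasurableSpace Ω] {μ : Measure Ω} [IsProbabilityMeasure μ] {X : Ω → ℝ}

/-- Linearize the square: `exp(x²/4)` is the mean of `exp(xg/√2)` over a standard Gaussian `g`.
After exchanging integrals, the subgaussian bound leaves the mean of `exp(g²/4)`, which is `√2`. -/
theorem lintegral_exp_sq_div_four_le (hX : HasSubgaussianMGF X 1 μ) (hXm : Measurable X) :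
    ∫⁻ ω, ENNReal.ofReal (Real.exp (X ω ^ 2 / 4)) ∂μ ≤ ENNReal.ofReal 2 := by
  have hs : √2 ^ 2 = (2 : ℝ) := Real.sq_sqrt zero_le_two
  have h1 : ∀ x : ℝ, ENNReal.ofReal (Real.exp (x ^ 2 / 4)) =
      ∫⁻ g, ENNReal.ofReal (Real.exp (x / √2 * g)) ∂gaussianReal 0 1 := fun x => by
    rw [← ofReal_integral_eq_lintegral_ofReal (integrable_exp_mul_gaussianReal _)
      (ae_of_all _ fun _ => (Real.exp_pos _).le)]
    have := congrFun (mgf_id_gaussianReal (μ := 0) (v := 1)) (x / √2)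
    simp only [mgf, id] at this
    rw [this]
    congr 2
    rw [div_pow, hs]
    simp; ring
  simp_rw [h1]
  rw [lintegral_lintegral_swap (by fun_prop)]
  have h2 : ∀ g : ℝ, ∫⁻ ω, ENNReal.ofReal (Real.exp (X ω / √2 * g)) ∂μ ≤
      ENNReal.ofReal (Real.exp (-(-(1 / 4) * g ^ 2))) := fun g => by
    have he : ∀ ω, X ω / √2 * g = (g / √2) * X ω := fun ω => by ring
    simp_rw [he]
    rw [← ofReal_integral_eq_lintegral_ofReal (hX.integrable_exp_mul _)
      (ae_of_all _ fun _ => (Real.exp_pos _).le)]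
    apply ENNReal.ofReal_le_ofReal
    refine (hX.mgf_le (g / √2)).trans (le_of_eq ?_)
    rw [div_pow, hs]
    congr 1
    simp; ring
  refine (lintegral_mono h2).trans ?_
  rw [lintegral_exp_neg_mul_sq_gaussianReal (by norm_num)]
  apply ENNReal.ofReal_le_ofReal
  have : (1 + 2 * -(1 / 4) : ℝ) = 2⁻¹ := by norm_num
  rw [this, Real.inv_rpow zero_le_two, Real.rpow_neg zero_le_two, inv_inv]
  calc (2 : ℝ) ^ (1 / 2 : ℝ) ≤ 2 ^ (1 : ℝ) :=
        Real.rpow_le_rpow_of_exponent_le one_le_two (by norm_num)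
    _ = 2 := Real.rpow_one 2

/-- Second-order Taylor bound. The quadratic remainder is absorbed by `y² ≤ 128 exp(|y|/8)`, and the
total exponent is at most `|y|/4 ≤ 1/4 + x²/4`. -/
theorem exp_mul_sq_sub_one_le {t : ℝ} (ht : |t| ≤ 1 / 8) (x : ℝ) :
    Real.exp (t * (x ^ 2 - 1)) ≤
      1 + t * (x ^ 2 - 1) + 256 * t ^ 2 * Real.exp (x ^ 2 / 4) := by
  set y := x ^ 2 - 1 with hy
  have h1 : |Real.exp (t * y) - (1 + t * y)| ≤ |t * y| ^ 2 * Real.exp |t * y| := by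
    have := Complex.norm_exp_sub_sum_le_norm_mul_exp ((t * y : ℝ) : ℂ) 2
    rwa [show Complex.exp ((t * y : ℝ) : ℂ) - ∑ i ∈ Finset.range 2,
      ((t * y : ℝ) : ℂ) ^ i / (i.factorial : ℂ) = ((Real.exp (t * y) - (1 + t * y) : ℝ) : ℂ) by
        push_cast; simp [Finset.sum_range_succ], Complex.norm_real, Complex.norm_real,
      Real.norm_eq_abs, Real.norm_eq_abs] at this
  have hya : |y| ≤ x ^ 2 + 1 := by
    rw [abs_le]; constructor <;> nlinarith [sq_nonneg x]
  have h2 : |t * y| ≤ |y| / 8 := by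
    rw [abs_mul]; nlinarith [abs_nonneg y]
  have h3 : |y| ^ 2 ≤ 128 * Real.exp (|y| / 8) := by
    have := Real.quadratic_le_exp_of_nonneg (x := |y| / 8) (by positivity)
    nlinarith [abs_nonneg y]
  have h4 : Real.exp (|y| / 8) * Real.exp |t * y| ≤ 2 * Real.exp (x ^ 2 / 4) := by
    have hlog : Real.exp (1 / 4) ≤ 2 := by
      rw [← Real.le_log_iff_exp_le two_pos]; linarith [Real.log_two_gt_d9]
    rw [← Real.exp_add]
    calc _ ≤ Real.exp (1 / 4 + x ^ 2 / 4) := Real.exp_le_exp.2 (by linarith)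
      _ = Real.exp (1 / 4) * Real.exp (x ^ 2 / 4) := Real.exp_add _ _
      _ ≤ _ := by gcongr
  have h5 : |t * y| ^ 2 * Real.exp |t * y| ≤ 256 * t ^ 2 * Real.exp (x ^ 2 / 4) := by
    calc |t * y| ^ 2 * Real.exp |t * y| = t ^ 2 * (|y| ^ 2 * Real.exp |t * y|) := by
          rw [abs_mul, mul_pow, sq_abs t]; ring
      _ ≤ t ^ 2 * (128 * Real.exp (|y| / 8) * Real.exp |t * y|) := by gcongr
      _ = t ^ 2 * 128 * (Real.exp (|y| / 8) * Real.exp |t * y|) := by ring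
      _ ≤ t ^ 2 * 128 * (2 * Real.exp (x ^ 2 / 4)) := by gcongr
      _ = _ := by ring
  have := le_abs_self (Real.exp (t * y) - (1 + t * y))
  linarith

theorem lintegral_exp_mul_sq_sub_one_le (hX : HasSubgaussianMGF X 1 μ) (hXm : Measurable X)
    (hvar : ∫ ω, X ω ^ 2 ∂μ = 1) {t : ℝ} (ht : |t| ≤ 1 / 8) :
    ∫⁻ ω, ENNReal.ofReal (Real.exp (t * (X ω ^ 2 - 1))) ∂μ ≤
      ENNReal.ofReal (Real.exp (512 * t ^ 2)) := by
  have h4 := lintegral_exp_sq_div_four_le hX hXm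
  have hint4 : Integrable (fun ω => Real.exp (X ω ^ 2 / 4)) μ := by
    refine ⟨by fun_prop, ?_⟩
    rw [hasFiniteIntegral_iff_ofReal (ae_of_all _ fun _ => (Real.exp_pos _).le)]
    exact h4.trans_lt ENNReal.ofReal_lt_top
  have hle4 : ∫ ω, Real.exp (X ω ^ 2 / 4) ∂μ ≤ 2 := by
    rw [integral_eq_lintegral_of_nonneg_ae (ae_of_all _ fun _ => (Real.exp_pos _).le)
      hint4.aestronglyMeasurable]
    exact ENNReal.toReal_le_of_le_ofReal zero_le_two h4
  have hsq : Integrable (fun ω => X ω ^ 2) μ := (hX.memLp 2).integrable_sq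
  have hint : Integrable (fun ω => 1 + t * (X ω ^ 2 - 1) + 256 * t ^ 2 * Real.exp (X ω ^ 2 / 4)) μ :=
    ((integrable_const _).add ((hsq.sub (integrable_const _)).const_mul _)).add (hint4.const_mul _)
  refine (lintegral_mono fun ω => ENNReal.ofReal_le_ofReal (exp_mul_sq_sub_one_le ht (X ω))).trans ?_
  rw [← ofReal_integral_eq_lintegral_ofReal hint
    (ae_of_all _ fun ω => (Real.exp_pos _).le.trans (exp_mul_sq_sub_one_le ht (X ω)))]
  apply ENNReal.ofReal_le_ofReal
  rw [integral_add, integral_add, integral_const_mul, integral_const_mul, integral_sub, hvar]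
  · simp only [integral_const, probReal_univ, smul_eq_mul, mul_one, sub_self, mul_zero, add_zero]
    have := Real.add_one_le_exp (512 * t ^ 2)
    nlinarith [sq_nonneg t]
  · exact hsq
  · exact integrable_const _
  · exact integrable_const _
  · exact (hsq.sub (integrable_const _)).const_mul _
  · exact (integrable_const _).add ((hsq.sub (integrable_const _)).const_mul _)
  · exact hint4.const_mul _

theorem measure_le_sum_sq_sub_one_le {m : ℕ} (hX : HasSubgaussianMGF X 1 μ) (hXm : Measurable X)
    (hvar : ∫ ω, X ω ^ 2 ∂μ = 1) {δ : ℝ} (hδ0 : 0 ≤ δ) (hδ : δ ≤ 1) {ς : ℝ} (hς : |ς| = 1) :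
    (Measure.pi fun _ : Fin m => μ) {r | m * δ ≤ ς * ∑ i, (X (r i) ^ 2 - 1)} ≤
      ENNReal.ofReal (Real.exp (-(m * δ ^ 2 / 2048))) := by
  -- This minimizes `512 t² - |t| δ`, with value `-δ²/2048`.
  set t := δ / 1024 * ς with ht
  have hta : |t| = δ / 1024 := by rw [ht, abs_mul, hς, mul_one, abs_of_nonneg (by positivity)]
  have ht8 : |t| ≤ 1 / 8 := by rw [hta]; linarith
  have hsub : {r : Fin m → Ω | m * δ ≤ ς * ∑ i, (X (r i) ^ 2 - 1)} ⊆
      {r | 1 ≤ ENNReal.ofReal (Real.exp (-(m * δ ^ 2 / 1024))) *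
        ∏ i, ENNReal.ofReal (Real.exp (t * (X (r i) ^ 2 - 1)))} := by
    intro r hr
    have hr : m * δ ≤ ς * ∑ i, (X (r i) ^ 2 - 1) := hr
    rw [Set.mem_ofPred_eq, ← ENNReal.ofReal_prod_of_nonneg (fun i _ => (Real.exp_pos _).le), ← Real.exp_sum,
      ← ENNReal.ofReal_mul (Real.exp_pos _).le, ← Real.exp_add, ← Finset.mul_sum,
      ENNReal.one_le_ofReal, Real.one_le_exp_iff]
    have := mul_le_mul_of_nonneg_left hr (by positivity : 0 ≤ δ / 1024)
    rw [ht]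
    nlinarith
  have hmeas : Measurable fun r : Fin m → Ω =>
      ∏ i, ENNReal.ofReal (Real.exp (t * (X (r i) ^ 2 - 1))) := by fun_prop
  refine (measure_mono hsub).trans ((meas_ge_le_lintegral_div
    (hmeas.const_mul _).aemeasurable one_ne_zero
    ENNReal.one_ne_top).trans ?_)
  rw [div_one, lintegral_const_mul' _ _ ENNReal.ofReal_ne_top, lintegral_pi_prod (fun _ : Fin m => μ)
    (f := fun _ ω => ENNReal.ofReal (Real.exp (t * (X ω ^ 2 - 1)))) (fun _ => by fun_prop)]
  refine (mul_le_mul_right (Finset.prod_le_prod' fun i _ =>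
    lintegral_exp_mul_sq_sub_one_le hX hXm hvar ht8) _).trans ?_
  rw [Finset.prod_const, Finset.card_univ, Fintype.card_fin, ← ENNReal.ofReal_pow
    (Real.exp_pos _).le, ← ENNReal.ofReal_mul (Real.exp_pos _).le, ← Real.exp_nat_mul,
    ← Real.exp_add]
  apply ENNReal.ofReal_le_ofReal
  apply Real.exp_le_exp.2
  apply le_of_eq
  rw [← sq_abs t, hta]
  ring

theorem measure_le_abs_sum_sq_sub_le {m : ℕ} (hX : HasSubgaussianMGF X 1 μ) (hXm : Measurable X)
    (hvar : ∫ ω, X ω ^ 2 ∂μ = 1) {δ : ℝ} (hδ0 : 0 ≤ δ) (hδ : δ ≤ 1) :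
    (Measure.pi fun _ : Fin m => μ) {r | m * δ ≤ |∑ i, X (r i) ^ 2 - m|} ≤
      ENNReal.ofReal (2 * Real.exp (-(m * δ ^ 2 / 2048))) := by
  have h1 := measure_le_sum_sq_sub_one_le (m := m) hX hXm hvar hδ0 hδ (ς := 1) (by simp)
  have h2 := measure_le_sum_sq_sub_one_le (m := m) hX hXm hvar hδ0 hδ (ς := -1) (by simp)
  rw [two_mul, ENNReal.ofReal_add (Real.exp_pos _).le (Real.exp_pos _).le]
  refine le_trans (measure_mono fun r hr => ?_) ((measure_union_le _ _).trans (add_le_add h1 h2))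
  have hr : m * δ ≤ |∑ i, X (r i) ^ 2 - m| := hr
  have hs : ∑ i, (X (r i) ^ 2 - 1) = ∑ i, X (r i) ^ 2 - m := by simp [Finset.sum_sub_distrib]
  rcases le_abs.1 hr with h | h
  · left; rw [Set.mem_ofPred_eq, hs]; linarith
  · right; rw [Set.mem_ofPred_eq, hs]; linarith

end Moment

theorem integral_dotProduct_sq {κ : Type*} [Fintype κ] {ν : Measure ℝ} [IsProbabilityMeasure ν]
    (hL : MemLp id 2 ν) (h0 : ∫ x, x ∂ν = 0) (h1 : ∫ x, x ^ 2 ∂ν = 1) (v : κ → ℝ) :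
    ∫ r, (v ⬝ᵥ r) ^ 2 ∂(Measure.pi fun _ : κ => ν) = v ⬝ᵥ v := by
  set μ := Measure.pi fun _ : κ => ν
  have hX : (fun r : κ → ℝ => v ⬝ᵥ r) = ∑ j, fun r : κ → ℝ => v j * r j := by
    ext r; simp [dotProduct]
  have hLj : ∀ j, MemLp (fun x : ℝ => v j * x) 2 ν := fun j => hL.const_mul (v j)
  have hLp : ∀ j, MemLp (fun r : κ → ℝ => v j * r j) 2 μ := fun j =>
    (hLj j).comp_measurePreserving (measurePreserving_eval (fun _ : κ => ν) j)
  have hmem : MemLp (fun r : κ → ℝ => v ⬝ᵥ r) 2 μ := by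
    rw [hX]; exact memLp_finsetSum' _ fun j _ => hLp j
  have hmean : ∫ r, v ⬝ᵥ r ∂μ = 0 := by
    simp only [dotProduct]
    rw [integral_finsetSum _ fun j _ => (hLp j).integrable one_le_two]
    refine Finset.sum_eq_zero fun j _ => ?_
    rw [integral_const_mul]
    have := integral_comp_eval (μ := fun _ : κ => ν) (i := j) (f := fun x : ℝ => x)
      aestronglyMeasurable_id
    rw [this, h0, mul_zero]
  have hvar := variance_eq_sub hmem
  have hvar2 := variance_sum_pi hLj
  rw [← hX] at hvar2
  have hvarj : ∀ j, Var[fun x : ℝ => v j * x; ν] = v j * v j := fun j => by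
    rw [variance_const_mul, show Var[fun x : ℝ => x; ν] = _ from variance_eq_sub hL]
    simp only [Pi.pow_apply, h0, h1]
    ring
  simp only [Pi.pow_apply, hmean] at hvar
  simp_rw [hvarj] at hvar2
  rw [dotProduct, ← hvar2, hvar]
  simp

/-! ### Singular values of the support block -/

section SingularValues
variable {m : ℕ} {κ : Type*} [Fintype κ]

/-- The linear map sending the `j`-th basis vector to `c j`. -/
noncomputable def colMap (c : κ → Fin m → ℝ) :
    EuclideanSpace ℝ κ →ₗ[ℝ] EuclideanSpace ℝ (Fin m) where
  toFun v := WithLp.toLp 2 fun i => v.ofLp ⬝ᵥ fun j => c j i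
  map_add' v w := by ext i; simp [add_dotProduct]
  map_smul' t v := by ext i; simp [smul_dotProduct]

theorem norm_colMap_sq (c : κ → Fin m → ℝ) (v : EuclideanSpace ℝ κ) :
    ‖colMap c v‖ ^ 2 = ∑ i, (v.ofLp ⬝ᵥ fun j => c j i) ^ 2 :=
  EuclideanSpace.real_norm_sq_eq _

theorem dotProduct_self_eq_norm_sq (v : EuclideanSpace ℝ κ) : v.ofLp ⬝ᵥ v.ofLp = ‖v‖ ^ 2 := by
  rw [EuclideanSpace.real_norm_sq_eq, dotProduct]
  exact Finset.sum_congr rfl fun i _ => (sq _).symm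

theorem measure_le_abs_norm_colMap_sq_sub_le {ν : Measure ℝ} [IsProbabilityMeasure ν]
    (hν : HasSubgaussianMGF id 1 ν) (h0 : ∫ x, x ∂ν = 0) (h1 : ∫ x, x ^ 2 ∂ν = 1)
    {v : EuclideanSpace ℝ κ} (hv : ‖v‖ = 1) {δ : ℝ} (hδ0 : 0 ≤ δ) (hδ : δ ≤ 1) :
    iidCols κ m ν {c | m * δ ≤ |‖colMap c v‖ ^ 2 - m|} ≤
      ENNReal.ofReal (2 * Real.exp (-(m * δ ^ 2 / 2048))) := by
  have hvv : v.ofLp ⬝ᵥ v.ofLp = 1 := by rw [dotProduct_self_eq_norm_sq, hv, one_pow]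
  have hX := hasSubgaussianMGF_dotProduct hν v.ofLp
  rw [hvv, Real.toNNReal_one] at hX
  have hXm : Measurable fun r : κ → ℝ => v.ofLp ⬝ᵥ r := by
    simp only [dotProduct]; fun_prop
  have hvar := integral_dotProduct_sq (hν.memLp 2) h0 h1 v.ofLp
  rw [hvv] at hvar
  refine le_trans (le_of_eq ?_) (measure_le_abs_sum_sq_sub_le (m := m) hX hXm hvar hδ0 hδ)
  have hmp := measurePreserving_transpose (κ := κ) (ι := Fin m) ν
  have hmeas : MeasurableSet {r : Fin m → κ → ℝ | m * δ ≤ |∑ i, (v.ofLp ⬝ᵥ r i) ^ 2 - m|} := by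
    refine measurableSet_le measurable_const ?_
    simp only [dotProduct]; fun_prop
  rw [← hmp.measure_preimage hmeas.nullMeasurableSet]
  simp only [norm_colMap_sq]
  rfl

theorem measure_exists_norm_colMap_sq_sub_le {ν : Measure ℝ} [IsProbabilityMeasure ν]
    (hν : HasSubgaussianMGF id 1 ν) (h0 : ∫ x, x ∂ν = 0) (h1 : ∫ x, x ^ 2 ∂ν = 1)
    {δ : ℝ} (hδ0 : 0 ≤ δ) (hδ : δ ≤ 1) :
    iidCols κ m ν {c | ¬ ∀ v, |‖colMap c v‖ ^ 2 - m * ‖v‖ ^ 2| ≤ 32 * (m * δ) * ‖v‖ ^ 2} ≤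
      ENNReal.ofReal (2 * 5 ^ Fintype.card κ * Real.exp (-(m * δ ^ 2 / 2048))) := by
  obtain ⟨N, hcard, hN1, hN⟩ := exists_half_net_unitSphere (EuclideanSpace ℝ κ)
  rw [finrank_euclideanSpace] at hcard
  have hsub : {c : κ → Fin m → ℝ | ¬ ∀ v, |‖colMap c v‖ ^ 2 - m * ‖v‖ ^ 2| ≤
      32 * (m * δ) * ‖v‖ ^ 2} ⊆ ⋃ w ∈ N, {c | m * δ ≤ |‖colMap c w‖ ^ 2 - m|} := by
    intro c hc
    by_contra hcon
    simp only [Set.mem_iUnion, Set.mem_ofPred_eq, not_exists, not_le] at hcon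
    exact hc fun v => abs_norm_sq_sub_le_of_net (colMap c) m hN1 hN (fun w hw => (hcon w hw).le) v
  refine (measure_mono hsub).trans ((measure_biUnion_finset_le _ _).trans ?_)
  refine (Finset.sum_le_sum fun w hw =>
    measure_le_abs_norm_colMap_sq_sub_le hν h0 h1 (hN1 w hw) hδ0 hδ).trans ?_
  rw [Finset.sum_const, nsmul_eq_mul, ← ENNReal.ofReal_natCast,
    ← ENNReal.ofReal_mul (Nat.cast_nonneg _)]
  apply ENNReal.ofReal_le_ofReal
  have : (N.card : ℝ) ≤ 5 ^ Fintype.card κ := by exact_mod_cast hcard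
  have hpos : 0 ≤ 2 * Real.exp (-(m * δ ^ 2 / 2048)) := by positivity
  nlinarith

theorem linearIndependent_of_le_norm_colMap_sq {c : κ → Fin m → ℝ} {b : ℝ} (hb : 0 < b)
    (h : ∀ v, b * ‖v‖ ^ 2 ≤ ‖colMap c v‖ ^ 2) : LinearIndependent ℝ c := by
  rw [Fintype.linearIndependent_iff]
  intro g hg
  have h0 : colMap c (WithLp.toLp 2 g) = 0 := by
    ext i
    simpa [colMap, dotProduct] using congrFun hg i
  have h1 := h (WithLp.toLp 2 g)
  rw [h0, norm_zero] at h1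
  have h2 : ‖(WithLp.toLp 2 g : EuclideanSpace ℝ κ)‖ = 0 := by
    by_contra hne
    have : 0 < ‖(WithLp.toLp 2 g : EuclideanSpace ℝ κ)‖ ^ 2 := by positivity
    nlinarith
  intro j
  simpa using congrArg (fun v : EuclideanSpace ℝ κ => v j) (norm_eq_zero.1 h2)

theorem certVec_dotProduct_self_le_of_le_norm_colMap_sq [DecidableEq κ] {c : κ → Fin m → ℝ} {b : ℝ}
    (hb : 0 < b) (h : ∀ v, b * ‖v‖ ^ 2 ≤ ‖colMap c v‖ ^ 2) {σ : κ → ℝ} (hσ : ∀ j, |σ j| = 1) :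
    b * (certVec σ c ⬝ᵥ certVec σ c) ≤ Fintype.card κ := by
  have hc := linearIndependent_of_le_norm_colMap_sq hb h
  have hτ := certVec_dotProduct_self hc σ
  have hτ0 : 0 ≤ certVec σ c ⬝ᵥ certVec σ c := Finset.sum_nonneg fun i _ => mul_self_nonneg _
  have h1 := h (WithLp.toLp 2 (certCoef σ c))
  have h2 : ‖colMap c (WithLp.toLp 2 (certCoef σ c))‖ ^ 2 = certVec σ c ⬝ᵥ certVec σ c := by
    rw [norm_colMap_sq]
    exact Finset.sum_congr rfl fun i _ => sq _
  rw [h2, ← dotProduct_self_eq_norm_sq] at h1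
  -- Cauchy–Schwarz gives `τ² ≤ ‖u‖² k` for the coefficient vector `u`; with `b‖u‖² ≤ τ` this
  -- becomes `bτ ≤ k`.
  have h3 : (certCoef σ c ⬝ᵥ σ) ^ 2 ≤ (certCoef σ c ⬝ᵥ certCoef σ c) * Fintype.card κ := by
    have := Finset.sum_mul_sq_le_sq_mul_sq Finset.univ (certCoef σ c) σ
    have hs : ∑ j, σ j ^ 2 = Fintype.card κ := by
      have : ∀ j, σ j ^ 2 = 1 := fun j => by rw [← sq_abs, hσ, one_pow]
      simp [this]
    rw [hs] at this
    simpa [dotProduct, sq] using this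
  rw [← hτ] at h3
  set τ := certVec σ c ⬝ᵥ certVec σ c
  simp only at h1
  rcases hτ0.eq_or_lt with h0 | h0
  · rw [← h0, mul_zero]; positivity
  · have h4 : b * τ ^ 2 ≤ τ * Fintype.card κ := by
      calc b * τ ^ 2 ≤ b * ((certCoef σ c ⬝ᵥ certCoef σ c) * Fintype.card κ) := by gcongr
        _ = (b * (certCoef σ c ⬝ᵥ certCoef σ c)) * Fintype.card κ := by ring
        _ ≤ _ := by gcongr
    refine le_of_mul_le_mul_left ?_ h0
    linarith [h4, sq τ]

end SingularValues

/-! ### The symmetric sign law -/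

section SignLaw

instance (a : ℝ) : IsProbabilityMeasure (symmetricSignLaw a) :=
  ⟨by simp [symmetricSignLaw, ENNReal.inv_two_add_inv_two]⟩

theorem integral_symmetricSignLaw (a : ℝ) (f : ℝ → ℝ) :
    ∫ x, f x ∂symmetricSignLaw a = (f a + f (-a)) / 2 := by
  rw [symmetricSignLaw, integral_add_measure
    ((integrable_dirac (by simp)).smul_measure (by simp))
    ((integrable_dirac (by simp)).smul_measure (by simp))]
  simp only [integral_smul_measure, integral_dirac]
  simp; ring

theorem map_mul_symmetricSignLaw (r a : ℝ) :
    (symmetricSignLaw a).map (r * ·) = symmetricSignLaw (r * a) := by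
  have h := measurable_const_mul r
  simp only [symmetricSignLaw, Measure.map_add _ _ h, Measure.map_smul, Measure.map_dirac' h,
    mul_neg]

theorem hasSubgaussianMGF_id_symmetricSignLaw :
    HasSubgaussianMGF id 1 (symmetricSignLaw 1) := by
  have h := hasSubgaussianMGF_of_mem_Icc_of_integral_eq_zero (X := id) (a := -1) (b := 1)
    (μ := symmetricSignLaw 1) aemeasurable_id ?_ ?_
  · convert h
    apply NNReal.eq
    norm_num
  · rw [symmetricSignLaw, ae_add_measure_iff]
    refine ⟨Measure.ae_smul_measure ?_ _, Measure.ae_smul_measure ?_ _⟩ <;>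
    · rw [ae_dirac_eq]
      simp
  · rw [integral_symmetricSignLaw]; simp

theorem IsBinaryMap.sqrt_smul {Ω : Type*} [MeasurableSpace Ω] {P : Measure Ω} {m n : ℕ}
    {Φ : Ω → Matrix (Fin m) (Fin n) ℝ} (h : IsBinaryMap Φ P) (hm : 0 < m) :
    HasIIDEntries (fun ω => √m • Φ ω) (symmetricSignLaw 1) P := by
  have := HasIIDEntries.const_smul h (√m)
  have hm' : √(m : ℝ) ≠ 0 := by positivity
  rwa [map_mul_symmetricSignLaw, mul_one_div_cancel hm'] at this

end SignLaw

/-! ### Binary case: numerical estimates -/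

section Numerics
variable {n m s k : ℕ} {β ε : ℝ}

theorem singular_value_failure_le (hβ : 1 < β) (hε : 0 < ε) (hε1 : ε < 1)
    (hk : 0 < k) (hks : k ≤ s) (hn : Real.exp (2 ^ 26 / ε ^ 2) ≤ (n : ℝ))
    (hm : 2 * β * ((1 - ε) ^ 2)⁻¹ * s * Real.log n + s ≤ (m : ℝ)) :
    2 * (2 * 5 ^ k * Real.exp (-(m * (ε / 64) ^ 2 / 2048))) ≤
      (n : ℝ) ^ (-((2 ^ 23)⁻¹ * β * ε ^ 2)) := by
  have hn0 : (0 : ℝ) < n := (Real.exp_pos _).trans_le hn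
  have hL : 2 ^ 26 / ε ^ 2 ≤ Real.log n := (Real.le_log_iff_exp_le hn0).2 hn
  rw [div_le_iff₀ (by positivity)] at hL
  set L := Real.log n with hLdef
  have hs1 : (1 : ℝ) ≤ s := by exact_mod_cast hk.trans_le hks
  have hks' : (k : ℝ) ≤ s := by exact_mod_cast hks
  have hL0 : 0 ≤ L := Real.log_natCast_nonneg n
  have hinv : 1 ≤ ((1 - ε) ^ 2)⁻¹ :=
    (one_le_inv₀ (by have := sub_pos.2 hε1; positivity)).2 (by nlinarith)
  have hm2 : 2 * β * s * L ≤ m := by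
    have h0 : 0 ≤ 2 * β * s * L := by positivity
    have := mul_le_mul_of_nonneg_left hinv h0
    nlinarith
  have hε2 : 0 < ε ^ 2 := by positivity
  have hmε : 2 * s * (β * (L * ε ^ 2)) ≤ m * ε ^ 2 := by nlinarith
  have hβL : L * ε ^ 2 ≤ β * (L * ε ^ 2) := by nlinarith
  have hA : 2 * s * 2 ^ 26 ≤ m * ε ^ 2 := by nlinarith
  have hB : 2 * (β * (L * ε ^ 2)) ≤ m * ε ^ 2 := by nlinarith
  have he2 : (5 : ℝ) ≤ Real.exp 2 := by
    have := Real.quadratic_le_exp_of_nonneg (x := 2) zero_le_two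
    linarith
  have h5 : (5 : ℝ) ^ k ≤ Real.exp (2 * k) := by
    calc (5 : ℝ) ^ k ≤ Real.exp 2 ^ k := by gcongr
      _ = Real.exp (2 * k) := by rw [← Real.exp_nat_mul, mul_comm]
  have h4 : 2 * (2 * (5 : ℝ) ^ k) ≤ Real.exp (4 * s) := by
    calc 2 * (2 * (5 : ℝ) ^ k) ≤ Real.exp 2 * Real.exp (2 * k) := by nlinarith [Real.exp_pos (2 * k)]
      _ = Real.exp (2 + 2 * k) := (Real.exp_add _ _).symm
      _ ≤ _ := Real.exp_le_exp.2 (by linarith)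
  rw [Real.rpow_def_of_pos hn0]
  calc 2 * (2 * 5 ^ k * Real.exp (-(m * (ε / 64) ^ 2 / 2048)))
      = 2 * (2 * 5 ^ k) * Real.exp (-(m * (ε / 64) ^ 2 / 2048)) := by ring
    _ ≤ Real.exp (4 * s) * Real.exp (-(m * (ε / 64) ^ 2 / 2048)) := by gcongr
    _ = Real.exp (4 * s + -(m * (ε / 64) ^ 2 / 2048)) := (Real.exp_add _ _).symm
    -- The decay is `mε²/2²³`. Half of it dominates `4s` by `hA`; the other half is at least
    -- `βLε²/2²³` by `hB`.
    _ ≤ _ := Real.exp_le_exp.2 (by rw [← hLdef]; norm_num at hA ⊢; linarith)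

theorem certificate_failure_le (hβ : 1 < β) (hε : 0 < ε) (hε1 : ε < 1)
    (hk : 0 < k) (hks : k ≤ s) (hn : Real.exp (2 ^ 26 / ε ^ 2) ≤ (n : ℝ))
    (hm : 2 * β * ((1 - ε) ^ 2)⁻¹ * s * Real.log n + s ≤ (m : ℝ)) {τ : ℝ} (hτ0 : 0 < τ)
    (hτ : m * (1 - ε / 2) * τ ≤ k) :
    2 * n * Real.exp (-1 / (2 * τ)) ≤ (n : ℝ) ^ (1 - β) := by
  have hn0 : (0 : ℝ) < n := (Real.exp_pos _).trans_le hn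
  have hL : 2 ^ 26 / ε ^ 2 ≤ Real.log n := (Real.le_log_iff_exp_le hn0).2 hn
  rw [div_le_iff₀ (by positivity)] at hL
  set L := Real.log n with hLdef
  have hk' : (0 : ℝ) < k := by exact_mod_cast hk
  have hks' : (k : ℝ) ≤ s := by exact_mod_cast hks
  have hs0 : (0 : ℝ) < s := hk'.trans_le hks'
  have hL0 : 0 ≤ L := Real.log_natCast_nonneg n
  have hε' : 0 < 1 - ε := sub_pos.2 hε1
  have hmain : β * L * (1 + ε / 2) ≤ 1 / (2 * τ) := by
    rw [le_div_iff₀ (by positivity)]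
    have h1 : 2 * β * s * L ≤ m * (1 - ε) ^ 2 := by
      have : 2 * β * ((1 - ε) ^ 2)⁻¹ * s * L ≤ m := by linarith
      calc 2 * β * s * L = 2 * β * ((1 - ε) ^ 2)⁻¹ * s * L * (1 - ε) ^ 2 := by field_simp
        _ ≤ _ := by gcongr
    have h2 : (1 - ε) ^ 2 * (1 + ε / 2) ≤ 1 - ε / 2 := by nlinarith [sq_nonneg ε]
    have h3 : 2 * β * s * L * (1 + ε / 2) * τ ≤ s := by
      calc 2 * β * s * L * (1 + ε / 2) * τ ≤ m * (1 - ε) ^ 2 * (1 + ε / 2) * τ := by gcongr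
        _ = m * ((1 - ε) ^ 2 * (1 + ε / 2)) * τ := by ring
        _ ≤ m * (1 - ε / 2) * τ := by gcongr
        _ ≤ s := hτ.trans hks'
    have h4 : s * (β * L * (1 + ε / 2) * (2 * τ)) ≤ s * 1 := by linarith
    exact le_of_mul_le_mul_left h4 hs0
  -- The surplus factor `1 + ε/2` in `hmain` absorbs the 2 from the two-sided tail.
  have hgain : Real.log 2 ≤ β * L * (ε / 2) := by
    have h1 : Real.log 2 ≤ 1 := by linarith [Real.log_two_lt_d9]
    have h2 : (2 : ℝ) ^ 26 ≤ L * ε := by nlinarith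
    have h3 : L * ε ≤ β * (L * ε) := by nlinarith [mul_nonneg hL0 hε.le]
    norm_num at h2
    linarith
  rw [Real.rpow_def_of_pos hn0]
  calc 2 * n * Real.exp (-1 / (2 * τ))
      = Real.exp (Real.log 2) * Real.exp L * Real.exp (-(1 / (2 * τ))) := by
        rw [Real.exp_log two_pos, Real.exp_log hn0, neg_div]
    _ = Real.exp (Real.log 2 + L + -(1 / (2 * τ))) := by rw [Real.exp_add, Real.exp_add]
    _ ≤ _ := Real.exp_le_exp.2 (by rw [← hLdef]; linarith)

end Numerics

/-! ### Binary case and conclusion -/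

theorem measure_not_exactRecovery_binary_le {Ω : Type*} [MeasurableSpace Ω] {P : Measure Ω}
    [IsProbabilityMeasure P] {n m s : ℕ} {β ε : ℝ} {x₀ : Fin n → ℝ}
    {Φ : Ω → Matrix (Fin m) (Fin n) ℝ} (hm0 : 0 < m) (hβ : 1 < β) (hε : 0 < ε) (hε1 : ε < 1)
    (hx₀ : IsSparse s x₀) (hΦ : HasIIDEntries Φ (symmetricSignLaw 1) P)
    (hn : Real.exp (2 ^ 26 / ε ^ 2) ≤ (n : ℝ))
    (hm : 2 * β * ((1 - ε) ^ 2)⁻¹ * s * Real.log n + s ≤ (m : ℝ)) [Nonempty {j // x₀ j ≠ 0}] :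
    P {ω | ¬ ExactRecovery (Φ ω) x₀} ≤
      ENNReal.ofReal ((n : ℝ) ^ (1 - β) + (n : ℝ) ^ (-((2 ^ 23)⁻¹ * β * ε ^ 2))) := by
  have hν := hasSubgaussianMGF_id_symmetricSignLaw
  have hks := card_support_le hx₀
  have hkpos : 0 < Fintype.card {j // x₀ j ≠ 0} := Fintype.card_pos
  have hbad := measure_exists_norm_colMap_sq_sub_le (κ := {j // x₀ j ≠ 0}) (m := m) hν
    (by rw [integral_symmetricSignLaw]; simp) (by rw [integral_symmetricSignLaw]; simp)
    (δ := ε / 64) (by positivity) (by linarith)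
  set μ := iidCols {j // x₀ j ≠ 0} m (symmetricSignLaw 1)
  set Bad : Set ({j // x₀ j ≠ 0} → Fin m → ℝ) :=
    {c | ¬ ∀ v, |‖colMap c v‖ ^ 2 - m * ‖v‖ ^ 2| ≤ 32 * (m * (ε / 64)) * ‖v‖ ^ 2} with hBad
  have hb : (0 : ℝ) < m * (1 - ε / 2) := by
    have : 0 < 1 - ε / 2 := by linarith
    positivity
  have hgood : ∀ c ∉ Bad, ∀ v, m * (1 - ε / 2) * ‖v‖ ^ 2 ≤ ‖colMap c v‖ ^ 2 := by
    intro c hc v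
    have hc : ∀ v, |‖colMap c v‖ ^ 2 - m * ‖v‖ ^ 2| ≤ 32 * (m * (ε / 64)) * ‖v‖ ^ 2 :=
      not_not.1 hc
    have := (abs_le.1 (hc v)).1
    linarith
  refine (measure_not_exactRecovery_le hν hΦ x₀).trans ?_
  have h1 : μ {c | ¬ LinearIndependent ℝ c} ≤ μ Bad := measure_mono fun c hc => by
    by_contra hcb
    exact hc (linearIndependent_of_le_norm_colMap_sq hb (hgood c hcb))
  have h2 : ∫⁻ c in {c | LinearIndependent ℝ c}, min 1 (ENNReal.ofReal (2 * n * Real.exp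
        (-1 / (2 * (certVec (supportSign x₀) c ⬝ᵥ certVec (supportSign x₀) c))))) ∂μ ≤
      μ Bad + ENNReal.ofReal ((n : ℝ) ^ (1 - β)) := by
    -- A measurable hull avoids proving `Bad` measurable. `Bad` is charged twice overall, here and
    -- for linear dependence.
    calc _ ≤ ∫⁻ c, ((toMeasurable μ Bad).indicator 1 c + ENNReal.ofReal ((n : ℝ) ^ (1 - β))) ∂μ := by
          refine (lintegral_mono fun c => ?_).trans (setLIntegral_le_lintegral _ _)
          by_cases hc : c ∈ Bad
          · rw [Set.indicator_of_mem (subset_toMeasurable _ _ hc)]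
            exact (min_le_left _ _).trans le_self_add
          · refine (min_le_right _ _).trans (le_trans ?_ le_add_self)
            apply ENNReal.ofReal_le_ofReal
            refine certificate_failure_le hβ hε hε1 hkpos hks hn hm
              (certVec_dotProduct_self_pos (linearIndependent_of_le_norm_colMap_sq hb (hgood c hc))
                fun j h => ?_)
              (certVec_dotProduct_self_le_of_le_norm_colMap_sq hb (hgood c hc) (abs_supportSign x₀))
            simpa [h] using abs_supportSign x₀ j
      _ = _ := by
          rw [lintegral_add_right _ measurable_const,
            lintegral_indicator_one (measurableSet_toMeasurable _ _), measure_toMeasurable]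
          simp
  calc _ ≤ μ Bad + (μ Bad + ENNReal.ofReal ((n : ℝ) ^ (1 - β))) := add_le_add h1 h2
    _ = ENNReal.ofReal ((n : ℝ) ^ (1 - β)) + ENNReal.ofReal 2 * μ Bad := by
        rw [ENNReal.ofReal_ofNat, two_mul]; ring
    _ ≤ ENNReal.ofReal ((n : ℝ) ^ (1 - β)) + ENNReal.ofReal 2 * ENNReal.ofReal
        (2 * 5 ^ Fintype.card {j // x₀ j ≠ 0} * Real.exp (-(m * (ε / 64) ^ 2 / 2048))) := by
        gcongr
    _ ≤ _ := by
        rw [← ENNReal.ofReal_mul zero_le_two, ENNReal.ofReal_add (by positivity) (by positivity)]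
        gcongr
        exact singular_value_failure_le hβ hε hε1 hkpos hks hn hm

theorem theorem1 :
    (∀ (n m s : ℕ) (β : ℝ) (x₀ : Fin n → ℝ)
        (Ω : Type*) [MeasurableSpace Ω] (P : Measure Ω) [IsProbabilityMeasure P]
        (Φ : Ω → Matrix (Fin m) (Fin n) ℝ),
        0 < n → 0 < s → 1 < β → IsSparse s x₀ → IsGaussianMap Φ P →
        2 * β * s * Real.log n + s ≤ (m : ℝ) →
        1 - 2 * (n : ℝ) ^ (-recoveryExponent β s) ≤ P.real {ω | ExactRecovery (Φ ω) x₀}) ∧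
    (∃ c₀ c₁ : ℝ, 0 < c₀ ∧ 0 < c₁ ∧
      ∀ (n m s : ℕ) (β ε : ℝ) (x₀ : Fin n → ℝ)
        (Ω : Type*) [MeasurableSpace Ω] (P : Measure Ω) [IsProbabilityMeasure P]
        (Φ : Ω → Matrix (Fin m) (Fin n) ℝ),
        0 < m → 1 < β → 0 < ε → ε < 1 → IsSparse s x₀ → IsBinaryMap Φ P →
        Real.exp (c₀ / ε ^ 2) ≤ (n : ℝ) →
        2 * β * ((1 - ε) ^ 2)⁻¹ * s * Real.log n + s ≤ (m : ℝ) →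
        1 - (n : ℝ) ^ (1 - β) - (n : ℝ) ^ (-(c₁ * β * ε ^ 2)) ≤
          P.real {ω | ExactRecovery (Φ ω) x₀}) := by
  refine ⟨?_, 2 ^ 26, (2 ^ 23)⁻¹, by positivity, by positivity, ?_⟩
  · intro n m s β x₀ Ω _ P _ Φ hn hs hβ hx₀ hΦ hm
    have hL : 0 ≤ Real.log n := Real.log_natCast_nonneg n
    have hs' : (1 : ℝ) ≤ s := by exact_mod_cast hs
    have hm0 : 0 < m := by
      have h0 : 0 ≤ 2 * β * s * Real.log n := by positivity
      have : (0 : ℝ) < m := by linarith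
      exact_mod_cast this
    have hr : √(m : ℝ) ≠ 0 := by positivity
    refine one_sub_le_measureReal_exactRecovery (by positivity) ?_
    by_cases hx : x₀ = 0
    -- Empty support: recovery is deterministic, and the certificate bounds need a nonempty support.
    · simp [hx, exactRecovery_zero]
    · obtain ⟨j, hj⟩ := Function.ne_iff.1 hx
      have : Nonempty {j // x₀ j ≠ 0} := ⟨⟨j, hj⟩⟩
      have hscale : {ω | ¬ ExactRecovery (Φ ω) x₀} = {ω | ¬ ExactRecovery (√m • Φ ω) x₀} := by
        ext ω
        simp only [Set.mem_ofPred_eq, exactRecovery_smul_iff hr]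
      rw [hscale]
      exact measure_not_exactRecovery_gaussian_le hn hs hβ hx₀ (hΦ.sqrt_smul hm0) hm
  · intro n m s β ε x₀ Ω _ P _ Φ hm0 hβ hε hε1 hx₀ hΦ hn hm
    have hr : √(m : ℝ) ≠ 0 := by positivity
    rw [sub_sub]
    refine one_sub_le_measureReal_exactRecovery (by positivity) ?_
    by_cases hx : x₀ = 0
    · simp [hx, exactRecovery_zero]
    · obtain ⟨j, hj⟩ := Function.ne_iff.1 hx
      have : Nonempty {j // x₀ j ≠ 0} := ⟨⟨j, hj⟩⟩
      have hscale : {ω | ¬ ExactRecovery (Φ ω) x₀} = {ω | ¬ ExactRecovery (√m • Φ ω) x₀} := by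
        ext ω
        simp only [Set.mem_ofPred_eq, exactRecovery_smul_iff hr]
      rw [hscale]
      exact measure_not_exactRecovery_binary_le hm0 hβ hε hε1 hx₀ (hΦ.sqrt_smul hm0) hn hm
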